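/- Let $N\ge 2$ sensors move in the plane, with positions $x_i\in\mathbb{R}^2$, $\mathbf{x}=(x_1,\dots,x_N)$, and cost functions $$f_i(\mathbf{x})=x_i^{T}r_{ii}x_i+x_i^{T}r_i+b_i+\sum_{j\in\mathcal{N}_i^p}c_{ij}\|x_i-x_j\|^2 ,$$ where $r_{ii}\in\mathbb{R}^{2\times 2}$ is symmetric positive definite and strictly diagonally dominant, $r_i\in\mathbb{R}^2$, $b_i\in\mathbb{R}$, $\mathcal{N}_i^p\subseteq\{1,\dots,N\}$ (the physical neighbours of $i$) and $c_{ij}>0$ for $j\in\mathcal{N}_i^p$. The sensors communicate over an undirected connected weighted graph with adjacency matrix $(a_{ij})$ ($a_{ij}=a_{ji}\ge 0$, $a_{ii}=0$). The dynamics are $$\dot x_i=u_i+g_i(\mathbf{x})+d_i(t),\qquad t\ge t_0,$$ where each $g_i$ is $C^2$ (so that its first and second partial derivatives are bounded on bounded sets), and each $d_i$ is $C^2$ on $[t_0,\infty)$ with $\dot d_i$ and $\ddot d_i$ bounded. The RISE-based strategy is $$u_i=-\frac{\partial f_i}{\partial x_i}(\mathbf{y}_i)-\hat z_i,\qquad \mathbf{y}_i=(y_{i1},\dots,y_{iN}),$$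 $$\dot y_{ij}=-\theta\bar\theta_{ij}\Big(\sum_{k=1}^N a_{ik}(y_{ij}-y_{kj})+a_{ij}(y_{ij}-x_j)\Big),$$ $$\dot{\hat x}_i=u_i+\hat z_i+(k_i^s+c_i)(x_i-\hat x_i),\qquad \dot{\hat z}_i=k_i^sc_i(x_i-\hat x_i)+\beta_i\,\mathrm{sgn}(x_i-\hat x_i),$$ with $y_{ij},\hat x_i,\hat z_i\in\mathbb{R}^2$, fixed constants $\bar\theta_{ij}>0$, and $\mathrm{sgn}$ taken componentwise. Solutions are understood in the sense of Filippov (absolutely continuous, satisfying the equations almost everywhere, with $\mathrm{sgn}(0)$ replaced by $[-1,1]$). Then the game has a unique Nash equilibrium $\mathbf{x}^*$. Put $\zeta_{i1}=x_i-\hat x_i$, $\zeta_{i2}=g_i(\mathbf{x})+d_i(t)-\hat z_i$, $\eta_{ij}=y_{ij}-x_j$, $\xi_i=x_i-x_i^*$, $\gamma_i=\dot\zeta_{i1}+c_i\zeta_{i1}$, and let $\mathcal{E}_f=(\zeta_1,\zeta_2,\eta,\xi,\gamma)$ be the stacked error vector with its Euclidean norm. For every $v_1>0$ there is $\theta^*(v_1)>0$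 such that for each $\theta>\theta^*$ there is $k_s^r(v_1,\theta)>0$ such that for all $k_i^s>k_s^r$ ($i=1,\dots,N$) there is $c^r(v_1,\theta,k_s)>0$ such that for all $c_i>c^r$ there is $\beta^r(v_1,\theta,k_s,c)>0$ such that for all $\beta_i>\beta^r$ the following holds. The solutions with $\|\mathcal{E}_f(t_0)\|\le v_1$, on whatever interval $[t_0,\tau]$ they are defined, satisfy $\|\mathcal{E}_f(t)\|\le B$ there with one common constant $B$ (so there is no finite escape time), and every solution on $[t_0,\infty)$ with $\|\mathcal{E}_f(t_0)\|\le v_1$ satisfies $$\|\mathcal{E}_f(t)\|\to 0\quad\text{as } t\to\infty .$$ In particular $\mathbf{x}(t)\to\mathbf{x}^*$: the sensors' positions converge asymptotically to the Nash equilibrium. -/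

import Mathlib

open Filter Topology MeasureTheory

namespace SensorSeeking

noncomputable section

/-- The plane in which every sensor moves. -/
abbrev Plane := EuclideanSpace ℝ (Fin 2)

/-- A profile `(x₁, …, x_N)` of sensor positions. -/
abbrev Profile (N : ℕ) := Fin N → Plane

/-! ### Games -/

/-- `xs` is a Nash equilibrium of the game with cost functions `f`: no player can lower its own
cost by a unilateral deviation. -/
def IsNash {N : ℕ} (f : Fin N → Profile N → ℝ) (xs : Profile N) : Prop :=
  ∀ (i : Fin N) (w : Plane), f i xs ≤ f i (Function.update xs i w)

/-- The partial gradient `∂f_i/∂x_i` of player `i`'s cost in its own action, evaluated at the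
profile `v`. -/
def ownGradient {N : ℕ} (f : Fin N → Profile N → ℝ) (i : Fin N) (v : Profile N) : Plane :=
  gradient (fun w : Plane => f i (Function.update v i w)) (v i)

/-- The data of a sensor connectivity game. -/
structure ConnectivityGame (N : ℕ) where
  /-- the matrices `r_ii` -/
  r : Fin N → Matrix (Fin 2) (Fin 2) ℝ
  /-- the vectors `r_i` -/
  q : Fin N → Plane
  /-- the constants `b_i` -/
  b : Fin N → ℝ
  /-- the physical neighbour sets -/
  nbr : Fin N → Finset (Fin N)
  /-- the weights `c_ij` -/
  w : Fin N → Fin N → ℝ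
  posDef : ∀ i, (r i).PosDef
  diagDominant : ∀ i k, ∑ l ∈ Finset.univ.erase k, |r i k l| < |r i k k|
  w_pos : ∀ i, ∀ j ∈ nbr i, 0 < w i j

/-- The cost of sensor `i`:
`x_iᵀ r_ii x_i + x_iᵀ r_i + b_i + ∑_{j physical neighbour of i} c_ij ‖x_i - x_j‖²`. -/
def ConnectivityGame.cost {N : ℕ} (G : ConnectivityGame N) (i : Fin N) (x : Profile N) : ℝ :=
  ((x i).ofLp ⬝ᵥ Matrix.mulVec (G.r i) (x i).ofLp + (x i).ofLp ⬝ᵥ (G.q i).ofLp + G.b i)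
    + ∑ j ∈ G.nbr i, G.w i j * ‖x i - x j‖ ^ 2

/-! ### Communication graph -/

/-- An undirected and connected weighted communication graph, given by its adjacency matrix. -/
structure CommGraph (N : ℕ) where
  a : Fin N → Fin N → ℝ
  nonneg : ∀ i j, 0 ≤ a i j
  diag : ∀ i, a i i = 0
  symm : ∀ i j, a i j = a j i
  connected : (SimpleGraph.fromRel fun i j => 0 < a i j).Connected

/-! ### Unmodelled terms and disturbances -/

/-- The disturbances are twice continuously differentiable on `[t₀, ∞)`, with bounded first and
second derivatives there. -/
def AdmissibleDisturbance {N : ℕ} (t₀ : ℝ) (d : Fin N → ℝ → Plane) : Prop :=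
  ∀ i, ContDiffOn ℝ 2 (d i) (Set.Ici t₀) ∧
    (∃ C, ∀ t ∈ Set.Ici t₀, ‖iteratedDerivWithin 1 (d i) (Set.Ici t₀) t‖ ≤ C) ∧
    (∃ C, ∀ t ∈ Set.Ici t₀, ‖iteratedDerivWithin 2 (d i) (Set.Ici t₀) t‖ ≤ C)

/-! ### The closed loop -/

/-- The gains of the seeking strategy: `θ_ij = θ * θbar i j`. -/
structure Gains (N : ℕ) where
  θ : ℝ
  θbar : Fin N → Fin N → ℝ
  ks : Fin N → ℝ
  c : Fin N → ℝ
  β : Fin N → ℝ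

/-- Everything that determines the closed loop: the costs `f`, the communication graph `A`, the
unmodelled terms `g`, the disturbances `d` and the gains `K`. -/
structure Loop (N : ℕ) where
  f : Fin N → Profile N → ℝ
  A : CommGraph N
  g : Fin N → Profile N → Plane
  d : Fin N → ℝ → Plane
  K : Gains N

/-- The state of the closed loop: positions `x_i`, estimates `y_ij` (by `i` of the position of
`j`), and observer states `x̂_i` and `ẑ_i`. -/
structure State (N : ℕ) where
  x : Profile N
  y : Fin N → Profile N
  xh : Profile N
  zh : Profile N

variable {N : ℕ}

/-- Control input `u_i = -∂f_i/∂x_i (y_i) - ẑ_i`. -/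
def Loop.u (P : Loop N) (s : State N) (i : Fin N) : Plane :=
  -ownGradient P.f i (s.y i) - s.zh i

/-- The extended state `z_i = g_i(x) + d_i(t)`. -/
def Loop.z (P : Loop N) (t : ℝ) (s : State N) (i : Fin N) : Plane :=
  P.g i s.x + P.d i t

/-- Right-hand side for `x_i`: `u_i + g_i(x) + d_i(t)`. -/
def Loop.xDot (P : Loop N) (t : ℝ) (s : State N) (i : Fin N) : Plane :=
  P.u s i + P.g i s.x + P.d i t

/-- Right-hand side for `y_ij`: `-θ_ij (∑_k a_ik (y_ij - y_kj) + a_ij (y_ij - x_j))`. -/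
def Loop.yDot (P : Loop N) (s : State N) (i j : Fin N) : Plane :=
  -((P.K.θ * P.K.θbar i j) •
    ((∑ k, P.A.a i k • (s.y i j - s.y k j)) + P.A.a i j • (s.y i j - s.x j)))

/-- Right-hand side for `x̂_i`: `u_i + ẑ_i + (k_i^s + c_i)(x_i - x̂_i)`. -/
def Loop.xhDot (P : Loop N) (s : State N) (i : Fin N) : Plane :=
  P.u s i + s.zh i + (P.K.ks i + P.K.c i) • (s.x i - s.xh i)

/-- The signum function made set-valued at its jump (Filippov regularization): `{sgn r}` for
`r ≠ 0`, and `[-1, 1]` for `r = 0`. -/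
def SGN (r : ℝ) : Set ℝ :=
  {v | v ∈ Set.Icc (-1 : ℝ) 1 ∧ (r ≠ 0 → v = Real.sign r)}

/-- Right-hand side for `ẑ_i`, set-valued where a component of `x_i - x̂_i` vanishes:
`k_i^s c_i (x_i - x̂_i) + β_i SGN (x_i - x̂_i)`, with `SGN` taken componentwise. -/
def Loop.zhDot (P : Loop N) (s : State N) (i : Fin N) : Set Plane :=
  {v | ∃ σ : Plane, (∀ k, σ k ∈ SGN ((s.x i - s.xh i) k)) ∧
    v = (P.K.ks i * P.K.c i) • (s.x i - s.xh i) + P.K.β i • σ}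

/-- `X` is a (Filippov) solution of the closed loop on the compact interval `[t₀, τ]`: it is
absolutely continuous there and satisfies the closed-loop equations at almost every time. -/
structure IsSolutionOn (P : Loop N) (t₀ τ : ℝ) (X : ℝ → State N) : Prop where
  ac_x : ∀ i, AbsolutelyContinuousOnInterval (fun t => (X t).x i) t₀ τ
  ac_y : ∀ i j, AbsolutelyContinuousOnInterval (fun t => (X t).y i j) t₀ τ
  ac_xh : ∀ i, AbsolutelyContinuousOnInterval (fun t => (X t).xh i) t₀ τ
  ac_zh : ∀ i, AbsolutelyContinuousOnInterval (fun t => (X t).zh i) t₀ τ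
  eq_x : ∀ i, ∀ᵐ t ∂(volume.restrict (Set.Icc t₀ τ)),
    HasDerivAt (fun t => (X t).x i) (P.xDot t (X t) i) t
  eq_y : ∀ i j, ∀ᵐ t ∂(volume.restrict (Set.Icc t₀ τ)),
    HasDerivAt (fun t => (X t).y i j) (P.yDot (X t) i j) t
  eq_xh : ∀ i, ∀ᵐ t ∂(volume.restrict (Set.Icc t₀ τ)),
    HasDerivAt (fun t => (X t).xh i) (P.xhDot (X t) i) t
  eq_zh : ∀ i, ∀ᵐ t ∂(volume.restrict (Set.Icc t₀ τ)),
    ∃ v ∈ P.zhDot (X t) i, HasDerivAt (fun t => (X t).zh i) v t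

/-! ### Error signals -/

/-- `ζ_i1 = x_i - x̂_i`. -/
def State.ζ₁ (s : State N) (i : Fin N) : Plane := s.x i - s.xh i

/-- `ζ_i2 = z_i - ẑ_i`. -/
def Loop.ζ₂ (P : Loop N) (t : ℝ) (s : State N) (i : Fin N) : Plane := P.z t s i - s.zh i

/-- `η_ij = y_ij - x_j`. -/
def State.η (s : State N) (i j : Fin N) : Plane := s.y i j - s.x j

/-- `ξ_i = x_i - x_i^*`. -/
def State.ξ (s : State N) (xs : Profile N) (i : Fin N) : Plane := s.x i - xs i

/-- The filtered signal `γ_i = (d/dt) ζ_i1 + c_i ζ_i1`, the derivative being the one prescribed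
by the closed loop. -/
def Loop.γ (P : Loop N) (t : ℝ) (s : State N) (i : Fin N) : Plane :=
  (P.xDot t s i - P.xhDot s i) + P.K.c i • s.ζ₁ i

/-- The Euclidean norm of the stacked error vector `𝓔_f = (ζ₁, ζ₂, η, ξ, γ)`. -/
def Loop.errNorm (P : Loop N) (xs : Profile N) (t : ℝ) (s : State N) : ℝ :=
  √((∑ i, ‖s.ζ₁ i‖ ^ 2) + (∑ i, ‖P.ζ₂ t s i‖ ^ 2) + (∑ i, ∑ j, ‖s.η i j‖ ^ 2)
    + (∑ i, ‖s.ξ xs i‖ ^ 2) + ∑ i, ‖P.γ t s i‖ ^ 2)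

end

end SensorSeeking

open SensorSeeking

/-! The estimates are centred at the observed positions: p = x̂ − x*, q = y − x̂, e = x − x̂ and ψ =
g(x̂) + d − ẑ − kˢe. In these variables ẑ drops out of p'ᵢ = −Hᵢ(p + qᵢ) + (kˢ + c)eᵢ, where H is
the linear part of the pseudo-gradient. Since g is evaluated at x̂, the drift Dg(x̂)p' in ψ' does
not involve ψ, so kˢ > 1 is enough and the drift is left to β.

Formation: H need not be monotone, because c_ij and c_ji may differ, but an M-matrix argument gives
weights u with Σ uᵢ⟨vᵢ, Hᵢv⟩ ≥ Σ‖vᵢ‖² (`exists_weights`); this also yields the unique equilibrium.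
The grounded Laplacians are coercive (`CommGraph.exists_coercive`). Hence for large θ the energy Σ
u‖p‖² + Σ θ̄⁻¹‖q‖² dissipates ‖p‖² + ‖q‖², up to an error linear in ‖e‖ while p and q stay below a
level R (`exists_formation_estimate`).

Observer: for ‖ψ‖²/(2β) + ‖e‖₁ − ⟨e, ḋ⟩/β the terms ⟨σ, ψ⟩ and ⟨ψ, ḋ⟩/β cancel, which leaves
dissipation of ‖ψ‖²/β and of c‖e‖ (`observer_estimate`). The latter is linear in ‖e‖ and grows with
c, just as the formation error does, so a weight λ = 16RC fixed before c absorbs that error. The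
drift carries a factor 1/β and is absorbed by β (`exists_drift_bound`, `lyapunov_decay`).

The sum V thus satisfies V' ≤ −αV wherever V ≤ m₀R². The initial value of V is bounded by an affine
function of R, so a large R puts it below this level, and `le_exp_mul_of_barrier` keeps it there
with exponential decay. The error norm is at most a constant times √V. The nonsmooth term is handled
almost everywhere: where |e_k| is differentiable, its derivative is the same for every Filippov
selection (`HasDerivAt.abs_of_mem_SGN`). -/

namespace AbsolutelyContinuousOnInterval

/-! ### Absolutely continuous functions and differential inequalities. -/

theorem lipschitz_comp {X Y : Type*} [PseudoMetricSpace X] [PseudoMetricSpace Y] {f : ℝ → X}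
    {φ : X → Y} {a b K : ℝ} (hf : AbsolutelyContinuousOnInterval f a b)
    (hφ : ∀ s ∈ Set.uIcc a b, ∀ t ∈ Set.uIcc a b, dist (φ (f s)) (φ (f t)) ≤ K * dist (f s) (f t)) :
    AbsolutelyContinuousOnInterval (fun t => φ (f t)) a b := by
  have h := Tendsto.const_mul K hf
  rw [mul_zero] at h
  refine squeeze_zero' (Eventually.of_forall fun E => Finset.sum_nonneg fun i _ => dist_nonneg) ?_ h
  filter_upwards [mem_inf_of_right (mem_principal_self _)] with E hE
  rw [Finset.mul_sum]
  exact Finset.sum_le_sum fun i hi => hφ _ (hE.1 i hi).1 _ (hE.1 i hi).2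

theorem pi {ι X : Type*} [Fintype ι] [SeminormedAddCommGroup X] {f : ℝ → ι → X} {a b : ℝ}
    (hf : ∀ i, AbsolutelyContinuousOnInterval (fun t => f t i) a b) :
    AbsolutelyContinuousOnInterval f a b := by
  have h := tendsto_finsetSum Finset.univ fun i _ => hf i
  rw [Finset.sum_const_zero] at h
  refine squeeze_zero (fun E => Finset.sum_nonneg fun i _ => dist_nonneg) (fun E => ?_) h
  rw [Finset.sum_comm]
  refine Finset.sum_le_sum fun k _ => ?_
  refine (dist_pi_le_iff (Finset.sum_nonneg fun i _ => dist_nonneg)).2 fun i => ?_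
  exact Finset.single_le_sum (f := fun i => dist (f (E.2 k).1 i) (f (E.2 k).2 i))
    (fun i _ => dist_nonneg) (Finset.mem_univ i)

theorem norm_comp {F : Type*} [SeminormedAddCommGroup F] {f : ℝ → F} {a b : ℝ}
    (hf : AbsolutelyContinuousOnInterval f a b) :
    AbsolutelyContinuousOnInterval (fun t => ‖f t‖) a b :=
  hf.lipschitz_comp (K := 1) (φ := fun x => ‖x‖) fun s _ t _ => by
    rw [one_mul, dist_eq_norm (f s)]
    exact dist_norm_norm_le (f s) (f t)

theorem norm_sq_comp {F : Type*} [SeminormedAddCommGroup F] {f : ℝ → F} {a b : ℝ}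
    (hf : AbsolutelyContinuousOnInterval f a b) :
    AbsolutelyContinuousOnInterval (fun t => ‖f t‖ ^ 2) a b := by
  simpa only [sq] using hf.norm_comp.fun_mul hf.norm_comp

theorem inner_comp {F : Type*} [NormedAddCommGroup F] [InnerProductSpace ℝ F] {f g : ℝ → F}
    {a b : ℝ} (hf : AbsolutelyContinuousOnInterval f a b)
    (hg : AbsolutelyContinuousOnInterval g a b) :
    AbsolutelyContinuousOnInterval (fun t => inner ℝ (f t) (g t)) a b := by
  have h := ((hf.fun_add hg).norm_sq_comp.fun_sub (hf.fun_sub hg).norm_sq_comp).const_mul (1 / 4)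
  refine h.congr fun E => ?_
  have e : ∀ t, (1 / 4 : ℝ) * (‖f t + g t‖ ^ 2 - ‖f t - g t‖ ^ 2) = inner ℝ (f t) (g t) := fun t => by
    rw [norm_add_sq_real, norm_sub_sq_real]; ring
  simp only [e]

theorem fun_sum {ι F : Type*} [SeminormedAddCommGroup F] {f : ι → ℝ → F} {a b : ℝ} (s : Finset ι)
    (hf : ∀ i ∈ s, AbsolutelyContinuousOnInterval (f i) a b) :
    AbsolutelyContinuousOnInterval (fun t => ∑ i ∈ s, f i t) a b := by
  classical
  induction s using Finset.induction_on with
  | empty =>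
    simp only [Finset.sum_empty]
    exact (LipschitzWith.const (0 : F)).lipschitzOnWith.absolutelyContinuousOnInterval
  | insert i s his ih =>
    simp only [Finset.sum_insert his]
    exact (hf i (Finset.mem_insert_self i s)).fun_add
      (ih fun j hj => hf j (Finset.mem_insert_of_mem hj))

/-- The fundamental theorem of calculus for absolutely continuous functions makes a sign condition
almost everywhere sufficient. -/
theorem le_of_ae_deriv_nonpos {f : ℝ → ℝ} {a b : ℝ} (hab : a ≤ b)
    (hf : AbsolutelyContinuousOnInterval f a b)
    (h : ∀ᵐ t, t ∈ Set.Icc a b → ∃ f', HasDerivAt f f' t ∧ f' ≤ 0) : f b ≤ f a := by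
  rw [← sub_nonpos, ← hf.integral_deriv_eq_sub, intervalIntegral.integral_of_le hab]
  refine integral_nonpos_of_ae ?_
  rw [Filter.EventuallyLE, ae_restrict_iff' measurableSet_Ioc]
  filter_upwards [h] with t ht hmem
  obtain ⟨f', hf', hle⟩ := ht ⟨hmem.1.le, hmem.2⟩
  simpa [hf'.deriv] using hle

theorem le_exp_mul_of_ae_deriv_le {f : ℝ → ℝ} {a b α : ℝ} (hab : a ≤ b)
    (hf : AbsolutelyContinuousOnInterval f a b)
    (h : ∀ᵐ t, t ∈ Set.Icc a b → ∃ f', HasDerivAt f f' t ∧ f' ≤ -α * f t) :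
    f b ≤ Real.exp (-α * (b - a)) * f a := by
  have hexp : AbsolutelyContinuousOnInterval (fun t => Real.exp (α * (t - a))) a b :=
    ContDiffOn.absolutelyContinuousOnInterval (by fun_prop)
  have key := (hexp.fun_mul hf).le_of_ae_deriv_nonpos hab ?_
  · have e : Real.exp (-α * (b - a)) = (Real.exp (α * (b - a)))⁻¹ := by
      rw [← Real.exp_neg]; ring_nf
    rw [e, ← div_eq_inv_mul, le_div_iff₀ (Real.exp_pos _), mul_comm]
    simpa using key
  · filter_upwards [h] with t ht hmem
    obtain ⟨f', hf', hle⟩ := ht hmem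
    have hd : HasDerivAt (fun t => Real.exp (α * (t - a))) (Real.exp (α * (t - a)) * α) t := by
      simpa using (((hasDerivAt_id t).sub_const a).const_mul α).exp
    refine ⟨_, hd.mul hf', ?_⟩
    nlinarith [mul_nonneg (Real.exp_pos (α * (t - a))).le (sub_nonneg.2 hle)]

/-- A barrier argument: a nonnegative function that starts below the level `c`, and decays
exponentially wherever it is below that level, stays below it and decays exponentially. -/
theorem le_exp_mul_of_barrier {f : ℝ → ℝ} {a b α c : ℝ} (hα : 0 ≤ α)
    (hf : AbsolutelyContinuousOnInterval f a b) (hf0 : ∀ t ∈ Set.Icc a b, 0 ≤ f t) (hc : f a < c)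
    (h : ∀ᵐ t, t ∈ Set.Icc a b → f t ≤ c → ∃ f', HasDerivAt f f' t ∧ f' ≤ -α * f t)
    {t : ℝ} (ht : t ∈ Set.Icc a b) : f t ≤ c ∧ f t ≤ Real.exp (-α * (t - a)) * f a := by
  have hab : a ≤ b := ht.1.trans ht.2
  have hcont : ContinuousOn f (Set.Icc a b) := by simpa [Set.uIcc_of_le hab] using hf.continuousOn
  have hsub : Set.Icc a b ⊆ {t | f t ≤ f a} := by
    -- Continuous induction: just to the right of a point with f ≤ f a, continuity keeps f below c,
    -- so the decay hypothesis applies there and f cannot increase.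
    refine IsClosed.Icc_subset_of_forall_mem_nhdsWithin ?_ (le_refl (f a)) ?_
    · rw [Set.inter_comm]
      exact hcont.preimage_isClosed_of_isClosed isClosed_Icc isClosed_Iic
    · rintro x ⟨hx : f x ≤ f a, hxI⟩
      have hxc : ∀ᶠ y in 𝓝[Set.Icc a b] x, f y < c :=
        (hcont x ⟨hxI.1, hxI.2.le⟩).eventually (gt_mem_nhds (hx.trans_lt hc))
      rw [eventually_nhdsWithin_iff] at hxc
      obtain ⟨ε, hε, hball⟩ := Metric.eventually_nhds_iff.1 hxc
      have hmin : x < min b (x + ε) := lt_min hxI.2 (by linarith)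
      filter_upwards [Ioo_mem_nhdsGT hmin] with y hy
      have hyb : y < b := hy.2.trans_le (min_le_left _ _)
      have hyε : y < x + ε := hy.2.trans_le (min_le_right _ _)
      have hle := (hf.mono (c := x) (d := y) (by
        rw [Set.uIcc_of_le hy.1.le, Set.uIcc_of_le hab]
        exact Set.Icc_subset_Icc hxI.1 hyb.le)).le_exp_mul_of_ae_deriv_le (α := α) hy.1.le (by
          filter_upwards [h] with s hs hsI
          have hsab : s ∈ Set.Icc a b := ⟨hxI.1.trans hsI.1, hsI.2.trans hyb.le⟩
          refine hs hsab (hball ?_ hsab).le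
          rw [Real.dist_eq, abs_of_nonneg (by linarith [hsI.1])]
          linarith [hsI.2])
      have h1 : Real.exp (-α * (y - x)) ≤ 1 := by
        rw [Real.exp_le_one_iff]
        nlinarith [hy.1]
      have h2 := hf0 x ⟨hxI.1, hxI.2.le⟩
      show f y ≤ f a
      nlinarith
  refine ⟨(hsub ht).trans hc.le, ?_⟩
  refine (hf.mono (c := a) (d := t) ?_).le_exp_mul_of_ae_deriv_le ht.1 ?_
  · rw [Set.uIcc_of_le ht.1, Set.uIcc_of_le hab]
    exact Set.Icc_subset_Icc le_rfl ht.2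
  · filter_upwards [h] with s hs hsI
    have hsab : s ∈ Set.Icc a b := ⟨hsI.1, hsI.2.trans ht.2⟩
    exact hs hsab ((hsub hsab).trans hc.le)

end AbsolutelyContinuousOnInterval

/-! ### M-matrices. -/

open scoped Matrix in
/-- A row diagonally dominant M-matrix `diag (ρ + ∑ₖ w · k) - w` has a positive left vector that it
maps to the all-ones vector. -/
theorem exists_pos_left_vector {n : Type*} [Fintype n] [DecidableEq n] (w : n → n → ℝ)
    (hw : ∀ i j, 0 ≤ w i j) (ρ : n → ℝ) (hρ : ∀ i, 0 < ρ i) :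
    ∃ u : n → ℝ, (∀ i, 0 < u i) ∧ ∀ j, u j * (ρ j + ∑ k, w j k) = 1 + ∑ i, u i * w i j := by
  let M : Matrix n n ℝ := Matrix.diagonal (fun i => ρ i + ∑ k, w i k) - Matrix.of w
  have hMv : ∀ (y : n → ℝ) i, (M *ᵥ y) i = ρ i * y i + ∑ k, w i k * (y i - y k) := fun y i => by
    simp only [M, Matrix.sub_mulVec, Pi.sub_apply, Matrix.mulVec_diagonal]
    simp only [Matrix.mulVec, dotProduct, Matrix.of_apply, mul_sub, Finset.sum_sub_distrib,
      ← Finset.sum_mul]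
    ring
  -- Minimum principle: at an index minimizing y the coupling terms are nonpositive, so the ρ-term
  -- forces the minimum to be nonnegative. Injectivity of M and entrywise nonnegativity of its
  -- inverse follow.
  have hmax : ∀ y : n → ℝ, (∀ i, 0 ≤ (M *ᵥ y) i) → ∀ i, 0 ≤ y i := fun y hy i => by
    obtain ⟨m, -, hm⟩ := Finset.exists_min_image Finset.univ y ⟨i, Finset.mem_univ i⟩
    refine le_trans ?_ (hm i (Finset.mem_univ i))
    have h1 := hy m
    rw [hMv] at h1
    have h2 : ∑ k, w m k * (y m - y k) ≤ 0 := Finset.sum_nonpos fun k _ =>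
      mul_nonpos_of_nonneg_of_nonpos (hw m k) (sub_nonpos.2 (hm k (Finset.mem_univ k)))
    by_contra! hneg
    nlinarith [hρ m]
  have hinj : Function.Injective M.mulVec := fun y z hyz => by
    have h0 : M *ᵥ (y - z) = 0 := by rw [Matrix.mulVec_sub, sub_eq_zero]; exact hyz
    have h0' : M *ᵥ (z - y) = 0 := by rw [Matrix.mulVec_sub, sub_eq_zero]; exact hyz.symm
    funext i
    have h1 := hmax (y - z) (fun i => by rw [h0]; rfl) i
    have h2 := hmax (z - y) (fun i => by rw [h0']; rfl) i
    simp only [Pi.sub_apply] at h1 h2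
    linarith
  have hunit : IsUnit M := Matrix.mulVec_injective_iff_isUnit.1 hinj
  have hdet : IsUnit M.det := (Matrix.isUnit_iff_isUnit_det M).1 hunit
  let u : n → ℝ := (fun _ => 1) ᵥ* M⁻¹
  have hu : u ᵥ* M = fun _ => 1 := by
    simp only [u, Matrix.vecMul_vecMul, Matrix.nonsing_inv_mul M hdet, Matrix.vecMul_one]
  have hu0 : ∀ i, 0 ≤ u i := fun i => by
    have h1 : ∀ j, 0 ≤ (M⁻¹ *ᵥ Pi.single i 1) j := hmax _ fun j => by
      rw [Matrix.mulVec_mulVec, Matrix.mul_nonsing_inv M hdet, Matrix.one_mulVec]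
      exact (Pi.single_nonneg.2 zero_le_one : (0 : n → ℝ) ≤ Pi.single i 1) j
    simp only [u, Matrix.vecMul, dotProduct, one_mul]
    exact Finset.sum_nonneg fun j _ => by simpa using h1 j
  have heq : ∀ j, u j * (ρ j + ∑ k, w j k) = 1 + ∑ i, u i * w i j := fun j => by
    have h1 := congrFun hu j
    simp only [M, Matrix.vecMul_sub, Pi.sub_apply, Matrix.vecMul_diagonal] at h1
    simp only [Matrix.vecMul, dotProduct, Matrix.of_apply] at h1
    linarith
  refine ⟨u, fun j => (hu0 j).lt_of_ne fun h0 => ?_, heq⟩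
  have h1 := heq j
  rw [← h0, zero_mul] at h1
  have h2 : 0 ≤ ∑ i, u i * w i j := Finset.sum_nonneg fun i _ => mul_nonneg (hu0 i) (hw i j)
  linarith

theorem pi_norm_sq_le_sum {ι E : Type*} [Fintype ι] [SeminormedAddCommGroup E] (v : ι → E) :
    ‖v‖ ^ 2 ≤ ∑ i, ‖v i‖ ^ 2 := by
  refine (Real.le_sqrt (norm_nonneg _) (Finset.sum_nonneg fun i _ => by positivity)).1 ?_
  refine (pi_norm_le_iff_of_nonneg (Real.sqrt_nonneg _)).2 fun i => Real.le_sqrt_of_sq_le ?_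
  exact Finset.single_le_sum (f := fun i => ‖v i‖ ^ 2) (fun i _ => by positivity)
    (Finset.mem_univ i)

/-! ### The game: pseudo-gradient, Nash equilibrium, communication graph. -/

namespace SensorSeeking

variable {N : ℕ}

namespace ConnectivityGame

/-- The weight `c_ij`, extended by zero to the pairs that are not neighbours. -/
noncomputable def wt (G : ConnectivityGame N) (i j : Fin N) : ℝ := if j ∈ G.nbr i then G.w i j else 0

theorem wt_nonneg (G : ConnectivityGame N) (i j : Fin N) : 0 ≤ G.wt i j := by
  unfold wt
  split_ifs with h
  · exact (G.w_pos i j h).le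
  · exact le_rfl

/-- The linear part of the `i`-th component of the pseudo-gradient. -/
noncomputable def hess (G : ConnectivityGame N) (i : Fin N) : Profile N →ₗ[ℝ] Plane :=
  let π : Fin N → Profile N →ₗ[ℝ] Plane := fun j => LinearMap.proj j
  (2 : ℝ) • (Matrix.toEuclideanLin (G.r i) ∘ₗ π i + ∑ j, G.wt i j • (π i - π j))

theorem hess_apply (G : ConnectivityGame N) (i : Fin N) (v : Profile N) :
    G.hess i v = (2 : ℝ) • (Matrix.toEuclideanLin (G.r i) (v i) + ∑ j, G.wt i j • (v i - v j)) := by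
  simp [hess, LinearMap.sum_apply]

theorem r_symm (G : ConnectivityGame N) (i : Fin N) : G.r i 1 0 = G.r i 0 1 := by
  simpa using (G.posDef i).isHermitian.apply 0 1

theorem inner_r (G : ConnectivityGame N) (i : Fin N) (x y : Plane) :
    inner ℝ (Matrix.toEuclideanLin (G.r i) x) y =
      (G.r i 0 0 * x 0 + G.r i 0 1 * x 1) * y 0 + (G.r i 0 1 * x 0 + G.r i 1 1 * x 1) * y 1 := by
  simp [PiLp.inner_apply, Matrix.toEuclideanLin, Matrix.toLpLin_apply, Fin.sum_univ_two,
    G.r_symm]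
  ring

/-- The dominance margin of each row is what remains once |2x₀x₁| ≤ x₀² + x₁² has absorbed the
off-diagonal term. -/
theorem r_coercive (G : ConnectivityGame N) (i : Fin N) :
    ∃ ρ > 0, ∀ x : Plane, ρ * ‖x‖ ^ 2 ≤ inner ℝ (Matrix.toEuclideanLin (G.r i) x) x := by
  have h0 := G.diagDominant i 0
  have h1 := G.diagDominant i 1
  have e0 : (Finset.univ.erase 0 : Finset (Fin 2)) = {1} := by decide
  have e1 : (Finset.univ.erase 1 : Finset (Fin 2)) = {0} := by decide
  rw [e0, Finset.sum_singleton, abs_of_pos (G.posDef i).diag_pos] at h0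
  rw [e1, Finset.sum_singleton, abs_of_pos (G.posDef i).diag_pos, r_symm] at h1
  refine ⟨min (G.r i 0 0 - |G.r i 0 1|) (G.r i 1 1 - |G.r i 0 1|),
    lt_min (by linarith) (by linarith), fun x => ?_⟩
  rw [inner_r, EuclideanSpace.norm_sq_eq, Fin.sum_univ_two, Real.norm_eq_abs, Real.norm_eq_abs,
    sq_abs, sq_abs]
  have a0 := min_le_left (G.r i 0 0 - |G.r i 0 1|) (G.r i 1 1 - |G.r i 0 1|)
  have a1 := min_le_right (G.r i 0 0 - |G.r i 0 1|) (G.r i 1 1 - |G.r i 0 1|)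
  have b0 := mul_le_mul_of_nonneg_right a0 (sq_nonneg (x 0))
  have b1 := mul_le_mul_of_nonneg_right a1 (sq_nonneg (x 1))
  have b2 : -(2 * (G.r i 0 1 * (x 0 * x 1))) ≤ |G.r i 0 1| * (x 0 ^ 2 + x 1 ^ 2) := by
    rcases abs_cases (G.r i 0 1) with ⟨h, h'⟩ | ⟨h, h'⟩ <;> rw [h]
    · nlinarith [mul_nonneg h' (sq_nonneg (x 0 + x 1))]
    · nlinarith [mul_nonneg (neg_nonneg.2 h'.le) (sq_nonneg (x 0 - x 1))]
  nlinarith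

/-- The cost is quadratic in the own action, so the expansion is exact. Its nonnegative remainder
gives both the gradient and the sufficiency of the first-order condition. A neighbour j = i
contributes nothing, hence the `erase`. -/
theorem cost_update (G : ConnectivityGame N) (i : Fin N) (v : Profile N) (h : Plane) :
    G.cost i (Function.update v i (v i + h)) = G.cost i v + inner ℝ (G.hess i v + G.q i) h +
      (inner ℝ (Matrix.toEuclideanLin (G.r i) h) h + ∑ j ∈ (G.nbr i).erase i, G.w i j * ‖h‖ ^ 2) := by
  classical
  have hsum : ∑ j ∈ G.nbr i, G.w i j * ‖Function.update v i (v i + h) i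
        - Function.update v i (v i + h) j‖ ^ 2 =
      ∑ j ∈ G.nbr i, G.w i j * ‖v i - v j‖ ^ 2 + 2 * inner ℝ (∑ j, G.wt i j • (v i - v j)) h +
        ∑ j ∈ (G.nbr i).erase i, G.w i j * ‖h‖ ^ 2 := by
    have hw : ∑ j, G.wt i j • (v i - v j) = ∑ j ∈ G.nbr i, G.w i j • (v i - v j) := by
      simp [wt, ite_smul, Finset.sum_ite_mem]
    have he : ∑ j ∈ (G.nbr i).erase i, G.w i j * ‖h‖ ^ 2 =
        ∑ j ∈ G.nbr i, if j = i then 0 else G.w i j * ‖h‖ ^ 2 := by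
      rw [← Finset.filter_ne', Finset.sum_filter]
      exact Finset.sum_congr rfl fun j _ => by by_cases hj : j = i <;> simp [hj]
    rw [hw, he, sum_inner, Finset.mul_sum, ← Finset.sum_add_distrib, ← Finset.sum_add_distrib]
    refine Finset.sum_congr rfl fun j _ => ?_
    by_cases hj : j = i
    · subst hj; simp
    · rw [Function.update_self, Function.update_of_ne hj, if_neg hj,
        show v i + h - v j = (v i - v j) + h by abel, norm_add_sq_real, inner_smul_left]
      simp; ring
  unfold cost
  rw [hsum, inner_add_left, hess_apply, inner_smul_left, inner_add_left, inner_r, inner_r,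
    Function.update_self]
  simp [Matrix.mulVec, dotProduct, Fin.sum_univ_two, PiLp.inner_apply, G.r_symm]
  ring

theorem remainder_nonneg (G : ConnectivityGame N) (i : Fin N) (h : Plane) :
    0 ≤ inner ℝ (Matrix.toEuclideanLin (G.r i) h) h + ∑ j ∈ (G.nbr i).erase i, G.w i j * ‖h‖ ^ 2 := by
  obtain ⟨ρ, hρ, hr⟩ := G.r_coercive i
  have h1 : 0 ≤ ∑ j ∈ (G.nbr i).erase i, G.w i j * ‖h‖ ^ 2 := Finset.sum_nonneg fun j hj =>
    mul_nonneg (G.w_pos i j (Finset.mem_of_mem_erase hj)).le (by positivity)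
  have h2 := hr h
  have h3 : 0 ≤ ρ * ‖h‖ ^ 2 := by positivity
  linarith

theorem hasGradientAt_cost (G : ConnectivityGame N) (i : Fin N) (v : Profile N) :
    HasGradientAt (fun w => G.cost i (Function.update v i w)) (G.hess i v + G.q i) (v i) := by
  rw [hasGradientAt_iff_isLittleO_nhds_zero]
  set T := LinearMap.toContinuousLinearMap (Matrix.toEuclideanLin (G.r i)) with hT
  have hO : (fun h : Plane => G.cost i (Function.update v i (v i + h))
      - G.cost i (Function.update v i (v i)) - inner ℝ (G.hess i v + G.q i) h)
      =O[𝓝 0] fun h => ‖h‖ ^ 2 := by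
    refine Asymptotics.IsBigO.of_bound (‖T‖ + ∑ j ∈ (G.nbr i).erase i, G.w i j)
      (Eventually.of_forall fun h => ?_)
    rw [cost_update, Function.update_eq_self]
    rw [show ∀ a b c : ℝ, a + b + c - a - b = c by intros; ring, Real.norm_eq_abs,
      abs_of_nonneg (G.remainder_nonneg i h), Real.norm_eq_abs, abs_of_nonneg (by positivity),
      add_mul, Finset.sum_mul]
    gcongr
    refine (real_inner_le_norm _ _).trans ?_
    have := T.le_opNorm h
    rw [sq, ← mul_assoc]
    gcongr
    exact this
  refine hO.trans_isLittleO ?_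
  simpa using (Asymptotics.isLittleO_norm_pow_id (E' := Plane) one_lt_two)

theorem ownGradient_cost (G : ConnectivityGame N) (i : Fin N) (v : Profile N) :
    ownGradient G.cost i v = G.hess i v + G.q i :=
  (G.hasGradientAt_cost i v).gradient

theorem isNash_iff (G : ConnectivityGame N) (xs : Profile N) :
    IsNash G.cost xs ↔ ∀ i, G.hess i xs + G.q i = 0 := by
  constructor
  · intro h i
    have hmin : IsLocalMin (fun w => G.cost i (Function.update xs i w)) (xs i) :=
      Eventually.of_forall fun w => by
        show G.cost i (Function.update xs i (xs i)) ≤ _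
        rw [Function.update_eq_self]
        exact h i w
    have h0 := hmin.hasFDerivAt_eq_zero (G.hasGradientAt_cost i xs).hasFDerivAt
    exact (InnerProductSpace.toDual ℝ Plane).map_eq_zero_iff.1 h0
  · intro h i w
    have h1 := G.cost_update i xs (w - xs i)
    rw [add_sub_cancel, h i, inner_zero_left] at h1
    have h2 := G.remainder_nonneg i (w - xs i)
    linarith

/-- Diagonal stability of the pseudo-gradient. -/
theorem exists_weights (G : ConnectivityGame N) :
    ∃ u : Fin N → ℝ, (∀ i, 0 < u i) ∧
      ∀ v : Profile N, ∑ i, ‖v i‖ ^ 2 ≤ ∑ i, u i * inner ℝ (v i) (G.hess i v) := by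
  choose ρ hρ hr using G.r_coercive
  obtain ⟨u, hu, hueq⟩ := exists_pos_left_vector G.wt G.wt_nonneg (fun i => 2 * ρ i)
    fun i => by linarith [hρ i]
  refine ⟨u, hu, fun v => ?_⟩
  -- By 2⟨vᵢ, vⱼ⟩ ≤ ‖vᵢ‖² + ‖vⱼ‖², the i-th term is at least row i of the M-matrix applied to the
  -- squared norms; the left vector `u` combines the rows into Σ‖vⱼ‖².
  have h1 : ∀ i, u i * (2 * ρ i * ‖v i‖ ^ 2 + ∑ j, G.wt i j * (‖v i‖ ^ 2 - ‖v j‖ ^ 2)) ≤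
      u i * inner ℝ (v i) (G.hess i v) := fun i => by
    refine mul_le_mul_of_nonneg_left ?_ (hu i).le
    rw [hess_apply, inner_smul_right, inner_add_right, inner_sum, mul_add, Finset.mul_sum,
      real_inner_comm]
    refine add_le_add (by linarith [hr i (v i)]) (Finset.sum_le_sum fun j _ => ?_)
    rw [inner_smul_right, inner_sub_right, real_inner_self_eq_norm_sq]
    have h2 := real_inner_le_norm (v i) (v j)
    have h3 : 2 * inner ℝ (v i) (v j) ≤ ‖v i‖ ^ 2 + ‖v j‖ ^ 2 := by
      nlinarith [sq_nonneg (‖v i‖ - ‖v j‖)]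
    have h4 := mul_le_mul_of_nonneg_left h3 (G.wt_nonneg i j)
    linarith
  refine le_trans (le_of_eq ?_) (Finset.sum_le_sum fun i _ => h1 i)
  have h2 : ∀ i, u i * (2 * ρ i * ‖v i‖ ^ 2 + ∑ j, G.wt i j * (‖v i‖ ^ 2 - ‖v j‖ ^ 2)) =
      u i * (2 * ρ i + ∑ j, G.wt i j) * ‖v i‖ ^ 2 - ∑ j, u i * G.wt i j * ‖v j‖ ^ 2 := fun i => by
    simp only [mul_sub, Finset.sum_sub_distrib, ← Finset.sum_mul, mul_assoc, ← Finset.mul_sum]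
    ring
  simp only [h2, Finset.sum_sub_distrib]
  rw [Finset.sum_comm, ← Finset.sum_sub_distrib]
  refine Finset.sum_congr rfl fun j _ => ?_
  rw [hueq j, ← Finset.sum_mul]
  ring

/-- Equilibria are the zeros of an affine map whose linear part is injective by weighted coercivity,
hence bijective in finite dimension. -/
theorem existsUnique_isNash (G : ConnectivityGame N) : ∃! xs : Profile N, IsNash G.cost xs := by
  let H : Profile N →ₗ[ℝ] Profile N := LinearMap.pi G.hess
  obtain ⟨u, -, hu⟩ := G.exists_weights
  have hinj : Function.Injective H := by
    rw [← LinearMap.ker_eq_bot, LinearMap.ker_eq_bot']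
    intro v hv
    have h1 := hu v
    have h2 : ∀ i, G.hess i v = 0 := fun i => congrFun hv i
    simp only [h2, inner_zero_right, mul_zero, Finset.sum_const_zero] at h1
    have h3 := pi_norm_sq_le_sum v
    have h4 : ‖v‖ = 0 := by nlinarith [norm_nonneg v]
    exact norm_eq_zero.1 h4
  have hsurj : Function.Surjective H := LinearMap.injective_iff_surjective.1 hinj
  obtain ⟨xs, hxs⟩ := hsurj (fun i => -G.q i)
  refine ⟨xs, (G.isNash_iff xs).2 fun i => ?_, fun y hy => hinj ?_⟩
  · rw [show G.hess i xs = -G.q i from congrFun hxs i, neg_add_cancel]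
  · rw [hxs]
    funext i
    exact eq_neg_of_add_eq_zero_left ((G.isNash_iff y).1 hy i)

theorem exists_hess_bound (G : ConnectivityGame N) :
    ∃ C > 0, ∀ i (v : Profile N), ‖G.hess i v‖ ^ 2 ≤ C * ∑ j, ‖v j‖ ^ 2 := by
  let T := fun i => LinearMap.toContinuousLinearMap (G.hess i)
  have hT : ∀ i, 0 ≤ ‖T i‖ ^ 2 := fun i => by positivity
  refine ⟨1 + ∑ i, ‖T i‖ ^ 2, by linarith [Finset.sum_nonneg fun i (_ : i ∈ Finset.univ) => hT i],
    fun i v => ?_⟩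
  have h1 : ‖G.hess i v‖ ≤ ‖T i‖ * ‖v‖ := (T i).le_opNorm v
  have h2 : ‖T i‖ ^ 2 ≤ ∑ i, ‖T i‖ ^ 2 :=
    Finset.single_le_sum (f := fun i => ‖T i‖ ^ 2) (fun i _ => hT i) (Finset.mem_univ i)
  calc ‖G.hess i v‖ ^ 2 ≤ (‖T i‖ * ‖v‖) ^ 2 := by gcongr
    _ = ‖T i‖ ^ 2 * ‖v‖ ^ 2 := by ring
    _ ≤ (1 + ∑ i, ‖T i‖ ^ 2) * ∑ j, ‖v j‖ ^ 2 := by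
      gcongr
      · linarith
      · exact pi_norm_sq_le_sum v

end ConnectivityGame

/-- The grounded Laplacians of a connected graph are uniformly positive definite. -/
theorem CommGraph.exists_coercive (A : CommGraph N) (hN : 2 ≤ N) :
    ∃ m > 0, ∀ (j : Fin N) (v : Profile N), m * ∑ i, ‖v i‖ ^ 2 ≤
      ∑ i, inner ℝ (v i) ((∑ k, A.a i k • (v i - v k)) + A.a i j • v i) := by
  let Q : Fin N → Profile N → ℝ := fun j v =>
    ∑ i, inner ℝ (v i) ((∑ k, A.a i k • (v i - v k)) + A.a i j • v i)
  have hQ : ∀ j v, 2 * Q j v = (∑ i, ∑ k, A.a i k * ‖v i - v k‖ ^ 2) +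
      2 * ∑ i, A.a i j * ‖v i‖ ^ 2 := fun j v => by
    have e1 : Q j v = (∑ i, ∑ k, A.a i k * inner ℝ (v i) (v i - v k)) +
        ∑ i, A.a i j * ‖v i‖ ^ 2 := by
      simp only [Q, inner_add_right, inner_sum, inner_smul_right, Finset.sum_add_distrib,
        real_inner_self_eq_norm_sq]
    have e2 : (∑ i, ∑ k, A.a i k * inner ℝ (v i) (v i - v k)) =
        ∑ i, ∑ k, A.a i k * inner ℝ (v k) (v k - v i) := by
      rw [Finset.sum_comm]
      exact Finset.sum_congr rfl fun i _ => Finset.sum_congr rfl fun k _ => by rw [A.symm]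
    have e3 : (∑ i, ∑ k, A.a i k * ‖v i - v k‖ ^ 2) =
        (∑ i, ∑ k, A.a i k * inner ℝ (v i) (v i - v k)) +
          ∑ i, ∑ k, A.a i k * inner ℝ (v k) (v k - v i) := by
      simp only [← Finset.sum_add_distrib]
      refine Finset.sum_congr rfl fun i _ => Finset.sum_congr rfl fun k _ => ?_
      rw [norm_sub_sq_real, inner_sub_right, inner_sub_right, real_inner_self_eq_norm_sq,
        real_inner_self_eq_norm_sq, real_inner_comm (v i) (v k)]
      ring
    rw [e1, e3, ← e2]
    ring
  -- If the form is not positive, edge energy and grounding term both vanish: v is constant by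
  -- connectedness, and zero at a neighbour of j, which exists because N ≥ 2.
  have hpos : ∀ j v, v ≠ 0 → 0 < Q j v := fun j v hv => by
    have t1 : ∀ i k, 0 ≤ A.a i k * ‖v i - v k‖ ^ 2 := fun i k =>
      mul_nonneg (A.nonneg i k) (by positivity)
    have t2 : ∀ i, 0 ≤ A.a i j * ‖v i‖ ^ 2 := fun i => mul_nonneg (A.nonneg i j) (by positivity)
    have s1 : 0 ≤ ∑ i, ∑ k, A.a i k * ‖v i - v k‖ ^ 2 :=
      Finset.sum_nonneg fun i _ => Finset.sum_nonneg fun k _ => t1 i k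
    have s2 : 0 ≤ ∑ i, A.a i j * ‖v i‖ ^ 2 := Finset.sum_nonneg fun i _ => t2 i
    by_contra! hle
    have hq := hQ j v
    have z1 : ∑ i, ∑ k, A.a i k * ‖v i - v k‖ ^ 2 = 0 := by linarith
    have z2 : ∑ i, A.a i j * ‖v i‖ ^ 2 = 0 := by linarith
    have hedge : ∀ i k, 0 < A.a i k → v i = v k := fun i k hik => by
      have y1 := (Finset.sum_eq_zero_iff_of_nonneg fun i _ =>
        Finset.sum_nonneg fun k _ => t1 i k).1 z1 i (Finset.mem_univ i)
      have y2 := (Finset.sum_eq_zero_iff_of_nonneg fun k _ => t1 i k).1 y1 k (Finset.mem_univ k)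
      have y3 := (mul_eq_zero.1 y2).resolve_left hik.ne'
      exact sub_eq_zero.1 (norm_eq_zero.1 (pow_eq_zero_iff two_ne_zero |>.1 y3))
    have hadj : ∀ i k, (SimpleGraph.fromRel fun i j => 0 < A.a i j).Adj i k → v i = v k :=
      fun i k h => by
        rw [SimpleGraph.fromRel_adj] at h
        exact h.2.elim (hedge i k) fun h => (hedge k i h).symm
    have hall : ∀ i k, v i = v k := fun i k => by
      obtain ⟨W⟩ := A.connected.preconnected i k
      induction W with
      | nil => rfl
      | cons h _ ih => exact (hadj _ _ h).trans ih
    have : Nontrivial (Fin N) := Fin.nontrivial_iff_two_le.2 hN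
    obtain ⟨k, hk⟩ := A.connected.preconnected.exists_adj_of_nontrivial j
    rw [SimpleGraph.fromRel_adj] at hk
    have hkj : 0 < A.a k j := hk.2.elim (fun h => by rwa [A.symm]) id
    have hvk : v k = 0 := by
      have y1 := (Finset.sum_eq_zero_iff_of_nonneg fun i _ => t2 i).1 z2 k (Finset.mem_univ k)
      have y3 := (mul_eq_zero.1 y1).resolve_left hkj.ne'
      exact norm_eq_zero.1 (pow_eq_zero_iff two_ne_zero |>.1 y3)
    exact hv (funext fun i => (hall i k).trans hvk)
  have hcont : ∀ j, Continuous (Q j) := fun j => by fun_prop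
  have hN0 : 0 < N := by omega
  have : Nonempty (Fin N) := ⟨⟨0, hN0⟩⟩
  -- Compactness of the unit sphere and homogeneity of degree two.
  have hm : ∀ j, ∃ m > 0, ∀ v : Profile N, m * ‖v‖ ^ 2 ≤ Q j v := fun j => by
    have hne : (Metric.sphere (0 : Profile N) 1).Nonempty := NormedSpace.sphere_nonempty.2 zero_le_one
    obtain ⟨v₀, hv₀, hmin⟩ := (isCompact_sphere (0 : Profile N) 1).exists_isMinOn hne
      (hcont j).continuousOn
    have hv₀0 : v₀ ≠ 0 := by
      rintro rfl
      simp at hv₀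
    refine ⟨Q j v₀, hpos j v₀ hv₀0, fun v => ?_⟩
    by_cases hv : v = 0
    · subst hv; simp [Q]
    have hnv : 0 < ‖v‖ := norm_pos_iff.2 hv
    have h1 : Q j v₀ ≤ Q j (‖v‖⁻¹ • v) := hmin (by
      rw [mem_sphere_zero_iff_norm, norm_smul, norm_inv, norm_norm, inv_mul_cancel₀ hnv.ne'])
    have h2 : Q j (‖v‖⁻¹ • v) = ‖v‖⁻¹ ^ 2 * Q j v := by
      simp only [Q, Pi.smul_apply, Finset.mul_sum, ← smul_sub, smul_comm _ (‖v‖⁻¹),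
        ← Finset.smul_sum, ← smul_add, inner_smul_left, inner_smul_right, sq]
      simp [mul_assoc]
    rw [h2] at h1
    calc Q j v₀ * ‖v‖ ^ 2 ≤ (‖v‖⁻¹ ^ 2 * Q j v) * ‖v‖ ^ 2 := by gcongr
      _ = Q j v := by field_simp
  choose m hm0 hm using hm
  obtain ⟨j₀, -, hj₀⟩ := Finset.exists_min_image Finset.univ m Finset.univ_nonempty
  -- `Profile N` carries the sup norm; passing to the sum of squares costs the factor N.
  refine ⟨m j₀ / N, by have := hm0 j₀; positivity, fun j v => le_trans ?_ (hm j v)⟩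
  have h1 : ∑ i, ‖v i‖ ^ 2 ≤ N * ‖v‖ ^ 2 := by
    refine (Finset.sum_le_card_nsmul Finset.univ _ (‖v‖ ^ 2) fun i _ => ?_).trans_eq (by simp)
    have := norm_le_pi_norm v i
    gcongr
  calc m j₀ / N * ∑ i, ‖v i‖ ^ 2 ≤ m j₀ / N * (N * ‖v‖ ^ 2) := by
        have := hm0 j₀
        gcongr
    _ = m j₀ * ‖v‖ ^ 2 := by field_simp
    _ ≤ m j * ‖v‖ ^ 2 := by
        have := hj₀ j (Finset.mem_univ j)
        gcongr

end SensorSeeking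

/-! ### Dissipation estimates for the formation and for the observer. -/

namespace SensorSeeking

variable {N : ℕ}

theorem two_mul_inner_le {E : Type*} [NormedAddCommGroup E] [InnerProductSpace ℝ E] (x y : E)
    {b B δ : ℝ} (hb : 0 ≤ b) (hbB : b ≤ B) (hδ : 0 < δ) :
    2 * b * inner ℝ x y ≤ δ * ‖y‖ ^ 2 + B ^ 2 / δ * ‖x‖ ^ 2 := by
  have h1 : 2 * b * inner ℝ x y ≤ 2 * B * (‖x‖ * ‖y‖) := by
    have h := real_inner_le_norm x y
    have h' : 0 ≤ ‖x‖ * ‖y‖ := by positivity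
    nlinarith [mul_le_mul_of_nonneg_left h hb]
  have h2 : δ * ‖y‖ ^ 2 + B ^ 2 / δ * ‖x‖ ^ 2 - 2 * B * (‖x‖ * ‖y‖) =
      (δ * ‖y‖ - B * ‖x‖) ^ 2 / δ := by
    field_simp
    ring
  have h3 : 0 ≤ (δ * ‖y‖ - B * ‖x‖) ^ 2 / δ := by positivity
  linarith

theorem two_mul_inner_le_of_norm_le {E : Type*} [NormedAddCommGroup E] [InnerProductSpace ℝ E]
    (x y : E) {b B R : ℝ} (hb : 0 ≤ b) (hbB : b ≤ B) (hx : ‖x‖ ≤ R) :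
    2 * b * inner ℝ x y ≤ 2 * B * R * ‖y‖ := by
  have h := real_inner_le_norm x y
  have hR : 0 ≤ R := (norm_nonneg x).trans hx
  have h' : inner ℝ x y ≤ R * ‖y‖ := h.trans (by gcongr)
  have h'' : 0 ≤ R * ‖y‖ := by positivity
  nlinarith [mul_le_mul_of_nonneg_left h' hb]

/-- The weights θ̄⁻¹ cancel the nonuniform rates, so consensus contributes θ times a symmetric
grounded Laplacian, which beats all other quadratic terms in q for large θ. Terms in e are kept
linear through ‖p‖, ‖q‖ ≤ R, so that a dissipation linear in ‖e‖ can absorb them. Neither θ₀ nor C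
depends on R or κ. -/
theorem exists_formation_estimate (G : ConnectivityGame N) (A : CommGraph N) (hN : 2 ≤ N)
    (θbar : Fin N → Fin N → ℝ) (hθbar : ∀ i j, 0 < θbar i j) (u : Fin N → ℝ) (hu : ∀ i, 0 < u i)
    (hcoer : ∀ v : Profile N, ∑ i, ‖v i‖ ^ 2 ≤ ∑ i, u i * inner ℝ (v i) (G.hess i v)) :
    ∃ θ₀ > 0, ∃ C > 0, ∀ θ > θ₀, ∀ (R : ℝ) (κ : Fin N → ℝ), (∀ i, 0 ≤ κ i) →
      ∀ (p : Profile N) (q : Fin N → Profile N) (e p' : Profile N) (q' : Fin N → Profile N),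
      (∀ i, ‖p i‖ ≤ R) → (∀ i j, ‖q i j‖ ≤ R) →
      (∀ i, p' i = -G.hess i (p + q i) + κ i • e i) →
      (∀ i j, q' i j = -((θ * θbar i j) •
        ((∑ k, A.a i k • (q i j - q k j)) + A.a i j • (q i j - e j))) - p' j) →
      ∑ i, 2 * u i * inner ℝ (p i) (p' i) + ∑ i, ∑ j, 2 * (θbar i j)⁻¹ * inner ℝ (q i j) (q' i j) ≤
        -(∑ i, ‖p i‖ ^ 2) - (∑ i, ∑ j, ‖q i j‖ ^ 2) + R * C * ∑ j, (θ + κ j) * ‖e j‖ := by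
  obtain ⟨m, hm, hL⟩ := A.exists_coercive hN
  obtain ⟨C, hC, hH⟩ := G.exists_hess_bound
  have hb : ∀ i j, 0 < (θbar i j)⁻¹ := fun i j => inv_pos.2 (hθbar i j)
  obtain ⟨U, hU0, hU⟩ : ∃ U > 0, ∀ i, u i ≤ U :=
    ⟨1 + ∑ i, u i, by linarith [Finset.sum_nonneg fun i (_ : i ∈ Finset.univ) => (hu i).le],
      fun i => by linarith [Finset.single_le_sum (fun i _ => (hu i).le) (Finset.mem_univ i)]⟩
  have hfin2 : ∀ b : Fin N → Fin N → ℝ, (∀ i j, 0 ≤ b i j) → ∃ B > 0, ∀ i j, b i j ≤ B :=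
    fun b hb => by
      have h0 : ∀ i, 0 ≤ ∑ j, b i j := fun i => Finset.sum_nonneg fun j _ => hb i j
      refine ⟨1 + ∑ i, ∑ j, b i j,
        by linarith [Finset.sum_nonneg fun i (_ : i ∈ Finset.univ) => h0 i], fun i j => ?_⟩
      have h1 := Finset.single_le_sum (fun j _ => hb i j) (Finset.mem_univ j)
      have h2 := Finset.single_le_sum (f := fun i => ∑ j, b i j) (fun i _ => h0 i)
        (Finset.mem_univ i)
      linarith
  obtain ⟨B, hB0, hB⟩ := hfin2 (fun i j => (θbar i j)⁻¹) fun i j => (hb i j).le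
  obtain ⟨a, ha0, ha⟩ := hfin2 A.a A.nonneg
  -- Coercivity supplies −2Σ‖p‖². Half a unit pays for the coupling with q in p'; δ makes the
  -- coupling with p in q', summed over all N² pairs, cost at most another half.
  set δ : ℝ := 1 / (2 * (N ^ 2 * C + 1)) with hδ
  have hδ0 : 0 < δ := by positivity
  have hδC : δ * (N ^ 2 * C) ≤ 1 / 2 := by
    rw [hδ, div_mul_eq_mul_div, div_le_div_iff₀ (by positivity) (by norm_num)]
    linarith
  -- The leading 1 is the dissipation kept in the conclusion; the rest collects the coefficients of
  -- Σ‖q‖² from `P1` and `P2`.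
  set Θ : ℝ := 1 + 2 * U ^ 2 * C + B ^ 2 / δ + N * C + B ^ 2 with hΘ
  refine ⟨Θ / (2 * m), by positivity, 2 * U + 2 * N * B + 2 * N * a, by positivity, ?_⟩
  intro θ hθ R κ hκ p q e p' q' hp hq hp' hq'
  have hR : 0 ≤ R := (norm_nonneg _).trans (hp ⟨0, by omega⟩)
  have hθ0 : 0 < θ := lt_trans (by positivity) hθ
  have hθm : Θ ≤ 2 * θ * m := by
    have := (div_lt_iff₀ (by positivity)).1 hθ
    linarith
  have P1 : ∀ i, 2 * u i * inner ℝ (p i) (p' i) ≤ -(2 * (u i * inner ℝ (p i) (G.hess i p))) +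
      1 / 2 * ‖p i‖ ^ 2 + 2 * U ^ 2 * C * ∑ j, ‖q i j‖ ^ 2 + 2 * U * R * (κ i * ‖e i‖) := fun i => by
    have h1 := two_mul_inner_le (G.hess i (q i)) (-p i) (hu i).le (hU i) (δ := 1 / 2) (by norm_num)
    have h2 := two_mul_inner_le_of_norm_le (p i) (κ i • e i) (hu i).le (hU i) (hp i)
    have h3 : B ^ 2 / (1 / 2) = 2 * B ^ 2 := by ring
    have h4 := mul_le_mul_of_nonneg_left (hH i (q i)) (by positivity : 0 ≤ 2 * U ^ 2)
    rw [norm_neg, inner_neg_right, real_inner_comm] at h1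
    rw [norm_smul, Real.norm_of_nonneg (hκ i)] at h2
    rw [hp', map_add, inner_add_right, inner_neg_right, inner_add_right]
    have h5 : U ^ 2 / (1 / 2) * ‖G.hess i (q i)‖ ^ 2 = 2 * U ^ 2 * ‖G.hess i (q i)‖ ^ 2 := by ring
    rw [h5] at h1
    linarith
  have P2 : ∀ i j, 2 * (θbar i j)⁻¹ * inner ℝ (q i j) (q' i j) ≤
      -(2 * θ * inner ℝ (q i j) ((∑ k, A.a i k • (q i j - q k j)) + A.a i j • q i j)) +
      2 * a * R * (θ * ‖e j‖) + δ * (C * ∑ k, ‖p k‖ ^ 2) + C * (∑ k, ‖q j k‖ ^ 2) +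
      (B ^ 2 / δ + B ^ 2) * ‖q i j‖ ^ 2 + 2 * B * R * (κ j * ‖e j‖) := fun i j => by
    have h1 := two_mul_inner_le (q i j) (G.hess j p) (hb i j).le (hB i j) hδ0
    have h2 := two_mul_inner_le (q i j) (G.hess j (q j)) (hb i j).le (hB i j) one_pos
    have h3 := two_mul_inner_le_of_norm_le (q i j) (-(κ j • e j)) (hb i j).le (hB i j) (hq i j)
    have h4 := two_mul_inner_le_of_norm_le (q i j) (θ • e j) (A.nonneg i j) (ha i j) (hq i j)
    have h5 := mul_le_mul_of_nonneg_left (hH j p) hδ0.le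
    have h6 := hH j (q j)
    rw [norm_neg, norm_smul, Real.norm_of_nonneg (hκ j), inner_neg_right] at h3
    rw [norm_smul, Real.norm_of_nonneg hθ0.le, inner_smul_right] at h4
    have h7 : (θbar i j)⁻¹ * (θ * θbar i j) = θ := by
      have := (hθbar i j).ne'
      field_simp
    have h8 : 2 * (θbar i j)⁻¹ * inner ℝ (q i j) (q' i j) =
        -(2 * ((θbar i j)⁻¹ * (θ * θbar i j)) *
          inner ℝ (q i j) ((∑ k, A.a i k • (q i j - q k j)) + A.a i j • q i j)) +
        2 * A.a i j * (((θbar i j)⁻¹ * (θ * θbar i j)) * inner ℝ (q i j) (e j)) +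
        2 * (θbar i j)⁻¹ * inner ℝ (q i j) (G.hess j p) +
        2 * (θbar i j)⁻¹ * inner ℝ (q i j) (G.hess j (q j)) +
        2 * (θbar i j)⁻¹ * -inner ℝ (q i j) (κ j • e j) := by
      rw [hq', hp', map_add]
      simp only [inner_sub_right, inner_add_right, inner_neg_right, inner_smul_right]
      ring
    rw [h8, h7]
    rw [div_one, one_mul] at h2
    linarith
  have S1 := Finset.sum_le_sum fun i (_ : i ∈ Finset.univ) => P1 i
  have S2 := Finset.sum_le_sum fun i (_ : i ∈ Finset.univ) =>
    Finset.sum_le_sum fun j (_ : j ∈ Finset.univ) => P2 i j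
  have S3 : m * ∑ i, ∑ j, ‖q i j‖ ^ 2 ≤ ∑ i, ∑ j,
      inner ℝ (q i j) ((∑ k, A.a i k • (q i j - q k j)) + A.a i j • q i j) := by
    rw [Finset.sum_comm, Finset.mul_sum, Finset.sum_comm (γ := Fin N)]
    exact Finset.sum_le_sum fun j _ => hL j fun i => q i j
  have S4 := hcoer p
  simp only [Finset.sum_add_distrib, Finset.sum_neg_distrib, ← Finset.mul_sum, Finset.sum_const,
    Finset.card_univ, Fintype.card_fin, nsmul_eq_mul] at S1 S2
  simp only [add_mul, Finset.sum_add_distrib, ← Finset.mul_sum]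
  set P := ∑ i, ‖p i‖ ^ 2
  set Q := ∑ i, ∑ j, ‖q i j‖ ^ 2
  set E := ∑ j, ‖e j‖
  set F := ∑ j, κ j * ‖e j‖
  have hP : 0 ≤ P := Finset.sum_nonneg fun i _ => by positivity
  have hQ : 0 ≤ Q := Finset.sum_nonneg fun i _ => Finset.sum_nonneg fun j _ => by positivity
  have hE : 0 ≤ E := Finset.sum_nonneg fun i _ => by positivity
  have hF : 0 ≤ F := Finset.sum_nonneg fun i _ => mul_nonneg (hκ i) (norm_nonneg _)
  have T1 := mul_le_mul_of_nonneg_right hδC hP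
  have T2 := mul_le_mul_of_nonneg_right hθm hQ
  have T3 := mul_le_mul_of_nonneg_left S3 (by positivity : 0 ≤ 2 * θ)
  have T4 : 0 ≤ R * (2 * U + 2 * N * B) * (θ * E) := by positivity
  have T5 : 0 ≤ R * (2 * N * a) * F := by positivity
  rw [hΘ] at T2
  linarith

/-- Two exact cancellations: −⟨ψ, σ⟩ from the switching term against ⟨σ, ψ⟩ from the ℓ¹ norm, and
⟨ψ, d₁⟩/β against the derivative of the correction −⟨e, d₁⟩/β. Half of the damping of ψ then
completes the square with w − kˢΔ. -/
theorem observer_estimate {E : Type*} [NormedAddCommGroup E] [InnerProductSpace ℝ E]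
    {β ks c D₁ D₂ : ℝ} (hβ : 0 < β) (hks : 0 < ks) (hc : 0 ≤ c) (e ψ Δ σ w d₁ d₂ : E)
    (hσ : ‖σ‖ ≤ 2) (heσ : ‖e‖ ≤ inner ℝ σ e) (hd₁ : ‖d₁‖ ≤ D₁) (hd₂ : ‖d₂‖ ≤ D₂) :
    1 / β * inner ℝ ψ (w + d₁ - ks • (ψ + Δ) - β • σ) + (inner ℝ σ (ψ + Δ - c • e) -
      1 / β * (inner ℝ (ψ + Δ - c • e) d₁ + inner ℝ e d₂)) ≤
    -(ks / (2 * β)) * ‖ψ‖ ^ 2 + ‖w - ks • Δ‖ ^ 2 / (2 * ks * β) + (2 + D₁ / β) * ‖Δ‖ -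
      (c * (1 - D₁ / β) - D₂ / β) * ‖e‖ := by
  have hβ' := hβ.ne'
  have e1 : 1 / β * inner ℝ ψ (w + d₁ - ks • (ψ + Δ) - β • σ) + (inner ℝ σ (ψ + Δ - c • e) -
      1 / β * (inner ℝ (ψ + Δ - c • e) d₁ + inner ℝ e d₂)) =
      1 / β * (inner ℝ ψ (w - ks • Δ) - ks * ‖ψ‖ ^ 2) + inner ℝ σ Δ - 1 / β * inner ℝ Δ d₁ -
        c * (inner ℝ σ e - 1 / β * inner ℝ e d₁) - 1 / β * inner ℝ e d₂ := by
    simp only [inner_sub_right, inner_add_right, inner_smul_right, inner_sub_left, inner_add_left,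
      real_inner_smul_left, real_inner_self_eq_norm_sq, real_inner_comm ψ σ]
    field_simp
    ring
  rw [e1]
  have h1 : 1 / β * (inner ℝ ψ (w - ks • Δ) - ks * ‖ψ‖ ^ 2) ≤
      -(ks / (2 * β)) * ‖ψ‖ ^ 2 + ‖w - ks • Δ‖ ^ 2 / (2 * ks * β) := by
    have h := real_inner_le_norm ψ (w - ks • Δ)
    have h' : -(ks / (2 * β)) * ‖ψ‖ ^ 2 + ‖w - ks • Δ‖ ^ 2 / (2 * ks * β) -
        1 / β * (‖ψ‖ * ‖w - ks • Δ‖ - ks * ‖ψ‖ ^ 2) =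
        (ks * ‖ψ‖ - ‖w - ks • Δ‖) ^ 2 / (2 * ks * β) := by
      field_simp
      ring
    have h'' : 0 ≤ (ks * ‖ψ‖ - ‖w - ks • Δ‖) ^ 2 / (2 * ks * β) := by positivity
    have h3 := mul_le_mul_of_nonneg_left h (by positivity : 0 ≤ 1 / β)
    linarith
  have h2 : inner ℝ σ Δ ≤ 2 * ‖Δ‖ := (real_inner_le_norm _ _).trans (by gcongr)
  have h3 : -(1 / β * inner ℝ Δ d₁) ≤ D₁ / β * ‖Δ‖ := by
    have h := neg_le_of_abs_le (abs_real_inner_le_norm Δ d₁)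
    have h' : ‖Δ‖ * ‖d₁‖ ≤ ‖Δ‖ * D₁ := by gcongr
    have := mul_le_mul_of_nonneg_left (show -inner ℝ Δ d₁ ≤ ‖Δ‖ * D₁ by linarith)
      (by positivity : 0 ≤ 1 / β)
    calc _ = 1 / β * -inner ℝ Δ d₁ := by ring
      _ ≤ _ := this
      _ = _ := by ring
  have h4 : (1 - D₁ / β) * ‖e‖ ≤ inner ℝ σ e - 1 / β * inner ℝ e d₁ := by
    have h := real_inner_le_norm e d₁
    have h' : ‖e‖ * ‖d₁‖ ≤ ‖e‖ * D₁ := by gcongr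
    have := mul_le_mul_of_nonneg_left (h.trans h') (by positivity : 0 ≤ 1 / β)
    calc (1 - D₁ / β) * ‖e‖ = ‖e‖ - 1 / β * (‖e‖ * D₁) := by ring
      _ ≤ _ := by linarith
  have h5 : -(1 / β * inner ℝ e d₂) ≤ D₂ / β * ‖e‖ := by
    have h := neg_le_of_abs_le (abs_real_inner_le_norm e d₂)
    have h' : ‖e‖ * ‖d₂‖ ≤ ‖e‖ * D₂ := by gcongr
    have := mul_le_mul_of_nonneg_left (show -inner ℝ e d₂ ≤ ‖e‖ * D₂ by linarith)
      (by positivity : 0 ≤ 1 / β)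
    calc _ = 1 / β * -inner ℝ e d₂ := by ring
      _ ≤ _ := this
      _ = _ := by ring
  have h6 := mul_le_mul_of_nonneg_left h4 hc
  linarith

end SensorSeeking

/-! ### The Lyapunov function and its decay inequality. -/

namespace SensorSeeking

variable {N : ℕ}

/-- The `ℓ¹` norm on the plane. -/
noncomputable def l1 (x : Plane) : ℝ := ∑ k, |x k|

theorem norm_le_l1 (x : Plane) : ‖x‖ ≤ l1 x := by
  rw [EuclideanSpace.norm_eq, l1, Fin.sum_univ_two, Fin.sum_univ_two, Real.sqrt_le_left (by positivity),
    Real.norm_eq_abs, Real.norm_eq_abs]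
  nlinarith [mul_nonneg (abs_nonneg (x 0)) (abs_nonneg (x 1))]

theorem l1_le (x : Plane) : l1 x ≤ 2 * ‖x‖ := by
  have h0 := PiLp.norm_apply_le x 0
  have h1 := PiLp.norm_apply_le x 1
  rw [Real.norm_eq_abs] at h0 h1
  rw [l1, Fin.sum_univ_two]
  linarith

theorem mul_eq_abs_of_mem_SGN {r v : ℝ} (h : v ∈ SGN r) : v * r = |r| := by
  rcases lt_trichotomy r 0 with hr | rfl | hr
  · rw [h.2 hr.ne, Real.sign_of_neg hr, abs_of_neg hr]; ring
  · simp
  · rw [h.2 hr.ne', Real.sign_of_pos hr, abs_of_pos hr]; ring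

theorem inner_eq_l1_of_mem_SGN {e σ : Plane} (h : ∀ k, σ k ∈ SGN (e k)) : inner ℝ σ e = l1 e := by
  rw [PiLp.inner_apply, l1]
  refine Finset.sum_congr rfl fun k _ => ?_
  rw [← mul_eq_abs_of_mem_SGN (h k)]
  simp [mul_comm]

theorem norm_le_two_of_mem_SGN {e σ : Plane} (h : ∀ k, σ k ∈ SGN (e k)) : ‖σ‖ ≤ 2 := by
  refine (norm_le_l1 σ).trans ?_
  rw [l1, Fin.sum_univ_two]
  have h0 := abs_le.2 (h 0).1
  have h1 := abs_le.2 (h 1).1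
  linarith

/-- The Lyapunov function of the closed loop, in the coordinates `p = x̂ - x^*`, `q = y - x̂`,
`e = x - x̂` and `ψ = g (x̂) + d - ẑ - k^s e`. -/
noncomputable def lyapunov (u : Fin N → ℝ) (b : Fin N → Fin N → ℝ) (lam : ℝ) (β : Fin N → ℝ)
    (p : Profile N) (q : Fin N → Profile N) (e ψ d₁ : Profile N) : ℝ :=
  ∑ i, u i * ‖p i‖ ^ 2 + ∑ i, ∑ j, b i j * ‖q i j‖ ^ 2 +
    lam * ∑ i, (1 / (2 * β i) * ‖ψ i‖ ^ 2 + (l1 (e i) - 1 / β i * inner ℝ (e i) (d₁ i)))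

section

variable {u : Fin N → ℝ} {b : Fin N → Fin N → ℝ} {lam : ℝ} {β : Fin N → ℝ} {p : Profile N}
  {q : Fin N → Profile N} {e ψ d₁ : Profile N} {D₁ : ℝ}

/-- Makes the indefinite correction ⟨e, d₁⟩/β harmless beside the ℓ¹ norm of e. -/
theorem abs_inner_div_le {x y : Plane} {β D : ℝ} (hβ : 0 < β) (hD : 4 * D ≤ β) (hy : ‖y‖ ≤ D) :
    |1 / β * inner ℝ x y| ≤ 1 / 4 * ‖x‖ := by
  rw [abs_mul, abs_of_pos (by positivity), one_div_mul_eq_div, div_le_iff₀ hβ]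
  have h1 := abs_real_inner_le_norm x y
  have h2 : ‖x‖ * ‖y‖ ≤ ‖x‖ * (β / 4) := by gcongr; linarith
  linarith

theorem le_lyapunov (hlam : 0 ≤ lam) (hβ : ∀ i, 0 < β i) (hD : ∀ i, 4 * D₁ ≤ β i)
    (hd : ∀ i, ‖d₁ i‖ ≤ D₁) :
    ∑ i, u i * ‖p i‖ ^ 2 + ∑ i, ∑ j, b i j * ‖q i j‖ ^ 2 +
      lam * ∑ i, (1 / (2 * β i) * ‖ψ i‖ ^ 2 + 1 / 2 * ‖e i‖) ≤ lyapunov u b lam β p q e ψ d₁ := by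
  unfold lyapunov
  gcongr with i
  have h1 := (abs_le.1 (abs_inner_div_le (x := e i) (hβ i) (hD i) (hd i))).2
  have h2 := norm_le_l1 (e i)
  linarith [norm_nonneg (e i)]

theorem lyapunov_le (hlam : 0 ≤ lam) (hβ : ∀ i, 0 < β i) (hD : ∀ i, 4 * D₁ ≤ β i)
    (hd : ∀ i, ‖d₁ i‖ ≤ D₁) :
    lyapunov u b lam β p q e ψ d₁ ≤ ∑ i, u i * ‖p i‖ ^ 2 + ∑ i, ∑ j, b i j * ‖q i j‖ ^ 2 +
      lam * ∑ i, (1 / (2 * β i) * ‖ψ i‖ ^ 2 + 3 * ‖e i‖) := by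
  unfold lyapunov
  gcongr with i
  have h1 := (abs_le.1 (abs_inner_div_le (x := e i) (hβ i) (hD i) (hd i))).1
  have h2 := l1_le (e i)
  linarith [norm_nonneg (e i)]

end

/-- The combination of the formation and the observer estimates. -/
theorem lyapunov_decay {u : Fin N → ℝ} {b : Fin N → Fin N → ℝ} {β ks c : Fin N → ℝ}
    {p : Profile N} {q : Fin N → Profile N} {e ψ d₁ : Profile N}
    {θ C R lam D₁ D₂ U B Cg ε X : ℝ} {Y Z Δ : Fin N → ℝ}
    (hlamdef : lam = 16 * R * C)
    (hC : 0 ≤ C) (hR : 0 ≤ R) (hβ : ∀ i, 0 < β i) (hks : ∀ i, 1 ≤ ks i)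
    (hU : ∀ i, u i ≤ U) (hB : ∀ i j, b i j ≤ B) (hU0 : 0 ≤ U) (hB0 : 0 ≤ B)
    (hD₁ : ∀ i, 4 * D₁ ≤ β i) (hD₂ : ∀ i, 4 * D₂ ≤ β i) (hd : ∀ i, ‖d₁ i‖ ≤ D₁)
    (hc1 : ∀ i, 1 ≤ c i) (hcθ : ∀ i, θ + ks i ≤ c i) (hcg : ∀ i, 8 * (N * (1 + 3 * Cg)) ≤ c i)
    (hε1 : ε ≤ 1) (hεN : lam * N * ε ≤ 1 / 2)
    (hX : X ≤ -(∑ i, ‖p i‖ ^ 2) - (∑ i, ∑ j, ‖q i j‖ ^ 2) +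
      R * C * ∑ j, (θ + (ks j + c j)) * ‖e j‖)
    (hY : ∀ i, Y i ≤ -(ks i / (2 * β i)) * ‖ψ i‖ ^ 2 + Z i + (2 + D₁ / β i) * Δ i -
      (c i * (1 - D₁ / β i) - D₂ / β i) * ‖e i‖)
    (hZ : ∀ i, Z i ≤ ε * (∑ i, ‖p i‖ ^ 2 + ∑ i, ∑ j, ‖q i j‖ ^ 2 + ∑ i, ‖e i‖))
    (hΔ0 : ∀ i, 0 ≤ Δ i) (hΔ : ∀ i, Δ i ≤ Cg * ∑ j, ‖e j‖) :
    X + lam * ∑ i, Y i ≤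
      -(1 / (12 + 2 * U + 2 * B)) * lyapunov u b lam β p q e ψ d₁ := by
  have hlam : 0 ≤ lam := by rw [hlamdef]; positivity
  have hV := lyapunov_le (u := u) (b := b) (p := p) (q := q) (e := e) (ψ := ψ) hlam hβ hD₁ hd
  generalize lyapunov u b lam β p q e ψ d₁ = V at hV ⊢
  have hY' : ∀ i, Y i ≤ -(1 / (2 * β i) * ‖ψ i‖ ^ 2) +
      ε * (∑ i, ‖p i‖ ^ 2 + ∑ i, ∑ j, ‖q i j‖ ^ 2) + (1 + 3 * Cg) * ∑ j, ‖e j‖ -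
      1 / 2 * (c i * ‖e i‖) := fun i => by
    have h1 : D₁ / β i ≤ 1 / 4 := by rw [div_le_iff₀ (hβ i)]; linarith [hD₁ i]
    have h2 : D₂ / β i ≤ 1 / 4 := by rw [div_le_iff₀ (hβ i)]; linarith [hD₂ i]
    have hE : 0 ≤ ∑ j, ‖e j‖ := Finset.sum_nonneg fun i _ => norm_nonneg _
    have h3 : (2 + D₁ / β i) * Δ i ≤ 3 * (Cg * ∑ j, ‖e j‖) :=
      mul_le_mul (by linarith) (hΔ i) (hΔ0 i) (by norm_num)
    have h4 : 1 / 2 * c i ≤ c i * (1 - D₁ / β i) - D₂ / β i := by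
      nlinarith [hc1 i]
    have h5 := mul_le_mul_of_nonneg_right h4 (norm_nonneg (e i))
    have h6 : 1 / (2 * β i) * ‖ψ i‖ ^ 2 ≤ ks i / (2 * β i) * ‖ψ i‖ ^ 2 := by
      have := hks i
      have := hβ i
      gcongr
    have h7 := mul_le_mul_of_nonneg_right hε1 hE
    linarith [hY i, hZ i]
  have S1 := Finset.sum_le_sum fun i (_ : i ∈ Finset.univ) => hY' i
  have S2 : ∑ j, (θ + (ks j + c j)) * ‖e j‖ ≤ 2 * ∑ j, c j * ‖e j‖ := by
    rw [Finset.mul_sum]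
    refine Finset.sum_le_sum fun j _ => ?_
    nlinarith [mul_le_mul_of_nonneg_right (hcθ j) (norm_nonneg (e j))]
  have S3 : 8 * (N * (1 + 3 * Cg)) * ∑ j, ‖e j‖ ≤ ∑ j, c j * ‖e j‖ := by
    rw [Finset.mul_sum]
    exact Finset.sum_le_sum fun j _ => mul_le_mul_of_nonneg_right (hcg j) (norm_nonneg _)
  have S4 : ∑ j, ‖e j‖ ≤ ∑ j, c j * ‖e j‖ := Finset.sum_le_sum fun j _ =>
    le_mul_of_one_le_left (norm_nonneg _) (hc1 j)
  have S5 : ∑ i, u i * ‖p i‖ ^ 2 ≤ U * ∑ i, ‖p i‖ ^ 2 := by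
    rw [Finset.mul_sum]
    exact Finset.sum_le_sum fun j _ => mul_le_mul_of_nonneg_right (hU j) (by positivity)
  have S6 : ∑ i, ∑ j, b i j * ‖q i j‖ ^ 2 ≤ B * ∑ i, ∑ j, ‖q i j‖ ^ 2 := by
    simp only [Finset.mul_sum]
    exact Finset.sum_le_sum fun i _ => Finset.sum_le_sum fun j _ =>
      mul_le_mul_of_nonneg_right (hB i j) (by positivity)
  simp only [Finset.sum_add_distrib, Finset.sum_sub_distrib, Finset.sum_neg_distrib,
    ← Finset.mul_sum, Finset.sum_const, Finset.card_univ, Fintype.card_fin, nsmul_eq_mul] at S1 hV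
  have hP : 0 ≤ ∑ i, ‖p i‖ ^ 2 := Finset.sum_nonneg fun i _ => by positivity
  have hQ : 0 ≤ ∑ i, ∑ j, ‖q i j‖ ^ 2 :=
    Finset.sum_nonneg fun i _ => Finset.sum_nonneg fun j _ => by positivity
  have hE : 0 ≤ ∑ i, ‖e i‖ := Finset.sum_nonneg fun i _ => by positivity
  have hΨ : 0 ≤ ∑ i, 1 / (2 * β i) * ‖ψ i‖ ^ 2 := Finset.sum_nonneg fun i _ => by
    have := hβ i
    positivity
  set PP := ∑ i, ‖p i‖ ^ 2
  set QQ := ∑ i, ∑ j, ‖q i j‖ ^ 2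
  set EE := ∑ i, ‖e i‖
  set FF := ∑ j, c j * ‖e j‖
  set ΨΨ := ∑ i, 1 / (2 * β i) * ‖ψ i‖ ^ 2
  clear_value PP QQ EE FF ΨΨ
  have hRC : R * C = lam / 16 := by rw [hlamdef]; ring
  -- The observer dissipates (λ/2)Σ c‖e‖. The formation error uses λ/8 of it, since θ + kˢ + c ≤ 2c
  -- and RC = λ/16; the Lipschitz and drift terms use another λ/8. The remaining λ/4 dominates
  -- (λ/4)Σ‖e‖. The drift also uses up half of the formation dissipation.
  have W1 : X + lam * ∑ i, Y i ≤ -(1 / 2 * (PP + QQ)) - lam * ΨΨ - lam * (1 / 4) * EE := by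
    have T1 := mul_le_mul_of_nonneg_left S1 hlam
    have T2 := mul_le_mul_of_nonneg_left S2 (by positivity : 0 ≤ lam / 16)
    have T3 := mul_le_mul_of_nonneg_left S3 (by positivity : 0 ≤ lam / 8)
    have T4 := mul_le_mul_of_nonneg_left S4 (by positivity : 0 ≤ lam / 4)
    have T5 := mul_le_mul_of_nonneg_right hεN (by positivity : 0 ≤ PP + QQ)
    rw [hRC] at hX
    linarith
  refine W1.trans ?_
  -- The 12 compares 3‖e‖ in the upper bound for V with the ‖e‖/4 dissipated.
  rw [neg_mul, le_neg, div_mul_eq_mul_div, one_mul, div_le_iff₀ (by positivity)]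
  have Z1 : 0 ≤ lam * ΨΨ := by positivity
  have Z2 : 0 ≤ lam * EE := by positivity
  have Z3 : 0 ≤ U * QQ := by positivity
  have Z4 : 0 ≤ B * PP := by positivity
  have Z5 : 0 ≤ (U + B) * (lam * ΨΨ) := by positivity
  have Z6 : 0 ≤ (U + B) * (lam * EE) := by positivity
  linarith

/-- The drift of the observer error is controlled by the formation error. -/
theorem exists_drift_bound (G : ConnectivityGame N) {Cg K r : ℝ} (hK : 0 ≤ K)
    (hr : 0 ≤ r) :
    ∃ M > 0, ∀ (ks κ : Fin N → ℝ) (p : Profile N) (q : Fin N → Profile N) (e p' w Δ : Profile N),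
      (∀ i, 0 ≤ ks i ∧ ks i ≤ K) → (∀ i, 0 ≤ κ i ∧ κ i ≤ K) → (∀ i, ‖e i‖ ≤ r) →
      (∀ i, p' i = -G.hess i (p + q i) + κ i • e i) → (∀ i, ‖w i‖ ≤ Cg * ‖p'‖) →
      (∀ i, ‖Δ i‖ ≤ Cg * ∑ j, ‖e j‖) →
      ∀ i, ‖w i - ks i • Δ i‖ ^ 2 ≤
        M * (∑ i, ‖p i‖ ^ 2 + ∑ i, ∑ j, ‖q i j‖ ^ 2 + ∑ i, ‖e i‖) := by
  obtain ⟨C, hC, hH⟩ := G.exists_hess_bound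
  refine ⟨1 + 6 * N * Cg ^ 2 * (C + K ^ 2 * (N * r)) + 2 * K ^ 2 * Cg ^ 2 * (N * r), by positivity, ?_⟩
  intro ks κ p q e p' w Δ hks hκ he hp' hw hΔ i
  have hP : 0 ≤ ∑ i, ‖p i‖ ^ 2 := Finset.sum_nonneg fun i _ => by positivity
  have hQ : 0 ≤ ∑ i, ∑ j, ‖q i j‖ ^ 2 :=
    Finset.sum_nonneg fun i _ => Finset.sum_nonneg fun j _ => by positivity
  have hE : 0 ≤ ∑ i, ‖e i‖ := Finset.sum_nonneg fun i _ => by positivity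
  have hEr : ∑ i, ‖e i‖ ≤ N * r :=
    (Finset.sum_le_card_nsmul Finset.univ _ r fun i _ => he i).trans_eq (by simp)
  have hqQ : ∀ j, ∑ k, ‖q j k‖ ^ 2 ≤ ∑ i, ∑ j, ‖q i j‖ ^ 2 := fun j =>
    Finset.single_le_sum (f := fun i => ∑ j, ‖q i j‖ ^ 2)
      (fun i _ => Finset.sum_nonneg fun j _ => by positivity) (Finset.mem_univ j)
  have heE : ∀ j, ‖e j‖ ≤ ∑ i, ‖e i‖ := fun j =>
    Finset.single_le_sum (f := fun i => ‖e i‖) (fun i _ => norm_nonneg _) (Finset.mem_univ j)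
  set PP := ∑ i, ‖p i‖ ^ 2 with hPP
  set QQ := ∑ i, ∑ j, ‖q i j‖ ^ 2
  set EE := ∑ i, ‖e i‖
  clear_value PP QQ EE
  -- Since ‖e‖ ≤ r, squares of e cost only a linear amount, which the linear dissipation can match.
  have hE2 : EE ^ 2 ≤ N * r * EE := by nlinarith
  have h1 : ∀ j, ‖p' j‖ ^ 2 ≤ 3 * (C * PP + C * QQ + K ^ 2 * (N * r * EE)) := fun j => by
    have a1 : ‖p' j‖ ≤ ‖G.hess j p‖ + ‖G.hess j (q j)‖ + κ j * ‖e j‖ := by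
      rw [hp', map_add]
      refine (norm_add_le _ _).trans ?_
      rw [norm_neg, norm_smul, Real.norm_of_nonneg (hκ j).1]
      gcongr
      exact norm_add_le _ _
    have a2 := hH j p
    have a3 := (hH j (q j)).trans (mul_le_mul_of_nonneg_left (hqQ j) hC.le)
    have a4 : (κ j * ‖e j‖) ^ 2 ≤ K ^ 2 * (N * r * EE) := by
      rw [mul_pow]
      have b1 := (hκ j).1
      have b2 := (hκ j).2
      have b3 : ‖e j‖ ^ 2 ≤ N * r * EE := by
        have := heE j
        calc ‖e j‖ ^ 2 ≤ EE ^ 2 := by gcongr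
          _ ≤ _ := hE2
      gcongr
    have a5 : ‖p' j‖ ^ 2 ≤ (‖G.hess j p‖ + ‖G.hess j (q j)‖ + κ j * ‖e j‖) ^ 2 := by gcongr
    nlinarith [sq_nonneg (‖G.hess j p‖ - ‖G.hess j (q j)‖),
      sq_nonneg (‖G.hess j p‖ - κ j * ‖e j‖), sq_nonneg (‖G.hess j (q j)‖ - κ j * ‖e j‖)]
  have h2 : ‖p'‖ ^ 2 ≤ N * (3 * (C * PP + C * QQ + K ^ 2 * (N * r * EE))) :=
    (pi_norm_sq_le_sum p').trans
      ((Finset.sum_le_card_nsmul Finset.univ _ _ fun j _ => h1 j).trans_eq (by simp))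
  have h3 : ‖w i - ks i • Δ i‖ ≤ Cg * ‖p'‖ + K * (Cg * EE) := by
    refine (norm_sub_le _ _).trans ?_
    rw [norm_smul, Real.norm_of_nonneg (hks i).1]
    have b1 := (hks i).2
    exact add_le_add (hw i) (mul_le_mul b1 (hΔ i) (norm_nonneg _) hK)
  have h4 : ‖w i - ks i • Δ i‖ ^ 2 ≤ (Cg * ‖p'‖ + K * (Cg * EE)) ^ 2 := by gcongr
  have h5 : (Cg * ‖p'‖ + K * (Cg * EE)) ^ 2 ≤ 2 * Cg ^ 2 * ‖p'‖ ^ 2 + 2 * K ^ 2 * Cg ^ 2 * EE ^ 2 := by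
    nlinarith [sq_nonneg (Cg * ‖p'‖ - K * (Cg * EE))]
  have h6 := mul_le_mul_of_nonneg_left h2 (by positivity : 0 ≤ 2 * Cg ^ 2)
  have h7 := mul_le_mul_of_nonneg_left hE2 (by positivity : 0 ≤ 2 * K ^ 2 * Cg ^ 2)
  have h8 : 0 ≤ 6 * N * Cg ^ 2 * C * EE := by positivity
  have h9 : 0 ≤ 6 * N * Cg ^ 2 * (K ^ 2 * (N * r)) * (PP + QQ) := by positivity
  have h10 : 0 ≤ 2 * K ^ 2 * Cg ^ 2 * (N * r) * (PP + QQ) := by positivity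
  linarith

end SensorSeeking

/-! ### Differentiation along Filippov solutions. -/

/-- At a time where `|f|` is differentiable, its derivative is `sgn (f) f'`, whatever value in
`[-1, 1]` the signum takes at `0`. -/
theorem HasDerivAt.abs_of_mem_SGN {f : ℝ → ℝ} {f' v t : ℝ} (hf : HasDerivAt f f' t)
    (habs : DifferentiableAt ℝ (fun s => |f s|) t) (hv : v ∈ SGN (f t)) :
    HasDerivAt (fun s => |f s|) (v * f') t := by
  by_cases h0 : f t = 0
  -- At a zero |f| is minimal, so its derivative is 0; then |f|, hence f, is o(s − t). So f' = 0 and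
  -- the value of v is irrelevant.
  · have hmin : IsLocalMin (fun s => |f s|) t := Eventually.of_forall fun s => by
      show |f t| ≤ |f s|
      rw [h0, abs_zero]
      exact abs_nonneg _
    have h1 : HasDerivAt (fun s => |f s|) 0 t := by
      have h := habs.hasDerivAt
      rwa [hmin.deriv_eq_zero] at h
    have h2 : HasDerivAt f 0 t := by
      rw [hasDerivAt_iff_isLittleO] at h1 ⊢
      simp only [h0, abs_zero, sub_zero, smul_zero] at h1 ⊢
      exact Asymptotics.isLittleO_norm_left.1 h1
    rw [hf.unique h2, mul_zero]
    exact h1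
  · rw [hv.2 h0]
    rcases lt_or_gt_of_ne h0 with h | h
    · rw [Real.sign_of_neg h]
      exact (hasDerivAt_abs_neg h).comp t hf
    · rw [Real.sign_of_pos h]
      exact (hasDerivAt_abs_pos h).comp t hf

namespace SensorSeeking

variable {N : ℕ}

theorem HasDerivAt.plane_apply {f : ℝ → Plane} {f' : Plane} {t : ℝ} (hf : HasDerivAt f f' t)
    (k : Fin 2) : HasDerivAt (fun s => f s k) (f' k) t :=
  (EuclideanSpace.proj (𝕜 := ℝ) k).hasFDerivAt.comp_hasDerivAt t hf

theorem dist_abs_apply_le (x y : Plane) (k : Fin 2) : dist |x k| |y k| ≤ 1 * dist x y := by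
  rw [one_mul, dist_eq_norm x y, Real.dist_eq]
  exact (abs_abs_sub_abs_le _ _).trans (PiLp.norm_apply_le (x - y) k)

theorem absolutelyContinuous_abs_apply {f : ℝ → Plane} {a b : ℝ}
    (hf : AbsolutelyContinuousOnInterval f a b) (k : Fin 2) :
    AbsolutelyContinuousOnInterval (fun t => |f t k|) a b :=
  AbsolutelyContinuousOnInterval.lipschitz_comp (φ := fun x : Plane => |x k|) hf
    fun s _ t _ => dist_abs_apply_le (f s) (f t) k

/-- The selection σ is arbitrary, so it can be the one occurring in the equation of ẑ, as the
cancellation in `observer_estimate` requires. -/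
theorem hasDerivAt_lyapunov {u : Fin N → ℝ} {b : Fin N → Fin N → ℝ} {lam : ℝ} {β : Fin N → ℝ}
    {p e ψ d₁ : ℝ → Profile N} {q : ℝ → Fin N → Profile N} {p' e' ψ' d₂ σ : Profile N}
    {q' : Fin N → Profile N} {t : ℝ} (hβ : ∀ i, 0 < β i)
    (hp : ∀ i, HasDerivAt (fun t => p t i) (p' i) t)
    (hq : ∀ i j, HasDerivAt (fun t => q t i j) (q' i j) t)
    (he : ∀ i, HasDerivAt (fun t => e t i) (e' i) t)
    (hψ : ∀ i, HasDerivAt (fun t => ψ t i) (ψ' i) t)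
    (hd : ∀ i, HasDerivAt (fun t => d₁ t i) (d₂ i) t)
    (habs : ∀ i k, DifferentiableAt ℝ (fun t => |e t i k|) t)
    (hσ : ∀ i k, σ i k ∈ SGN (e t i k)) :
    HasDerivAt (fun t => lyapunov u b lam β (p t) (q t) (e t) (ψ t) (d₁ t))
      ((∑ i, 2 * u i * inner ℝ (p t i) (p' i) + ∑ i, ∑ j, 2 * b i j * inner ℝ (q t i j) (q' i j)) +
        lam * ∑ i, (1 / β i * inner ℝ (ψ t i) (ψ' i) + (inner ℝ (σ i) (e' i) -
          1 / β i * (inner ℝ (e' i) (d₁ t i) + inner ℝ (e t i) (d₂ i))))) t := by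
  unfold lyapunov
  have h1 : ∀ i, HasDerivAt (fun t => u i * ‖p t i‖ ^ 2) (2 * u i * inner ℝ (p t i) (p' i)) t :=
    fun i => ((hp i).norm_sq.const_mul (u i)).congr_deriv (by ring)
  have h2 : ∀ i j, HasDerivAt (fun t => b i j * ‖q t i j‖ ^ 2)
      (2 * b i j * inner ℝ (q t i j) (q' i j)) t :=
    fun i j => ((hq i j).norm_sq.const_mul (b i j)).congr_deriv (by ring)
  have h3 : ∀ i, HasDerivAt (fun t => 1 / (2 * β i) * ‖ψ t i‖ ^ 2)
      (1 / β i * inner ℝ (ψ t i) (ψ' i)) t :=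
    fun i => ((hψ i).norm_sq.const_mul (1 / (2 * β i))).congr_deriv (by
      have := (hβ i).ne'
      field_simp)
  have h4 : ∀ i, HasDerivAt (fun t => l1 (e t i)) (inner ℝ (σ i) (e' i)) t := fun i => by
    have h : inner ℝ (σ i) (e' i) = ∑ k, σ i k * e' i k := by
      rw [PiLp.inner_apply]
      exact Finset.sum_congr rfl fun k _ => by simp [mul_comm]
    rw [h]
    exact HasDerivAt.fun_sum fun k _ =>
      (HasDerivAt.plane_apply (he i) k).abs_of_mem_SGN (habs i k) (hσ i k)
  have h5 : ∀ i, HasDerivAt (fun t => 1 / β i * inner ℝ (e t i) (d₁ t i))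
      (1 / β i * (inner ℝ (e' i) (d₁ t i) + inner ℝ (e t i) (d₂ i))) t :=
    fun i => (((he i).inner ℝ (hd i)).const_mul (1 / β i)).congr_deriv (by ring)
  exact ((HasDerivAt.fun_sum fun i _ => h1 i).fun_add (HasDerivAt.fun_sum fun i _ =>
    HasDerivAt.fun_sum fun j _ => h2 i j)).fun_add
    ((HasDerivAt.fun_sum fun i _ => (h3 i).fun_add ((h4 i).fun_sub (h5 i))).const_mul lam)

theorem absolutelyContinuous_lyapunov {u : Fin N → ℝ} {b : Fin N → Fin N → ℝ} {lam : ℝ}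
    {β : Fin N → ℝ} {p e ψ d₁ : ℝ → Profile N} {q : ℝ → Fin N → Profile N} {s t : ℝ}
    (hp : ∀ i, AbsolutelyContinuousOnInterval (fun t => p t i) s t)
    (hq : ∀ i j, AbsolutelyContinuousOnInterval (fun t => q t i j) s t)
    (he : ∀ i, AbsolutelyContinuousOnInterval (fun t => e t i) s t)
    (hψ : ∀ i, AbsolutelyContinuousOnInterval (fun t => ψ t i) s t)
    (hd : ∀ i, AbsolutelyContinuousOnInterval (fun t => d₁ t i) s t) :
    AbsolutelyContinuousOnInterval
      (fun t => lyapunov u b lam β (p t) (q t) (e t) (ψ t) (d₁ t)) s t := by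
  unfold lyapunov
  refine AbsolutelyContinuousOnInterval.fun_add (AbsolutelyContinuousOnInterval.fun_add ?_ ?_) ?_
  · exact .fun_sum _ fun i _ => .const_mul _ (hp i).norm_sq_comp
  · exact .fun_sum _ fun i _ => .fun_sum _ fun j _ => .const_mul _ (hq i j).norm_sq_comp
  · refine .const_mul _ (.fun_sum _ fun i _ => .fun_add (.const_mul _ (hψ i).norm_sq_comp)
      (.fun_sub (.fun_sum _ fun k _ => absolutelyContinuous_abs_apply (he i) k)
        (.const_mul _ ((he i).inner_comp (hd i)))))

theorem AdmissibleDisturbance.exists_derivs {t₀ : ℝ} {d : Fin N → ℝ → Plane}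
    (hd : AdmissibleDisturbance t₀ d) :
    ∃ (d₁ d₂ : ℝ → Profile N) (D : ℝ), 0 < D ∧
      (∀ t, t₀ < t → ∀ i, HasDerivAt (d i) (d₁ t i) t ∧
        HasDerivAt (fun t => d₁ t i) (d₂ t i) t) ∧
      (∀ t, t₀ ≤ t → ∀ i, ‖d₁ t i‖ ≤ D ∧ ‖d₂ t i‖ ≤ D) ∧
      ∀ τ, t₀ ≤ τ → ∀ i, AbsolutelyContinuousOnInterval (d i) t₀ τ ∧
        AbsolutelyContinuousOnInterval (fun t => d₁ t i) t₀ τ := by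
  choose hC h1 h2 using hd
  choose C₁ hC₁ using h1
  choose C₂ hC₂ using h2
  have hu : UniqueDiffOn ℝ (Set.Ici t₀) := uniqueDiffOn_Ici t₀
  have hsub : ∀ τ, t₀ ≤ τ → Set.uIcc t₀ τ ⊆ Set.Ici t₀ := fun τ hτ => by
    rw [Set.uIcc_of_le hτ]
    exact Set.Icc_subset_Ici_self
  have hC' : ∀ i, ContDiffOn ℝ 1 (derivWithin (d i) (Set.Ici t₀)) (Set.Ici t₀) := fun i =>
    (hC i).derivWithin hu (by norm_num)
  refine ⟨fun t i => derivWithin (d i) (Set.Ici t₀) t,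
    fun t i => derivWithin (derivWithin (d i) (Set.Ici t₀)) (Set.Ici t₀) t,
    1 + ∑ i, (|C₁ i| + |C₂ i|), by positivity, fun t ht i => ⟨?_, ?_⟩, fun t ht i => ?_,
    fun τ hτ i => ⟨?_, ?_⟩⟩
  · exact (((hC i).differentiableOn (by norm_num)) t ht.le).hasDerivWithinAt.hasDerivAt
      (Ici_mem_nhds ht)
  · exact (((hC' i).differentiableOn (by norm_num)) t ht.le).hasDerivWithinAt.hasDerivAt
      (Ici_mem_nhds ht)
  · have hs := Finset.single_le_sum (f := fun i => |C₁ i| + |C₂ i|) (fun i _ => by positivity)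
      (Finset.mem_univ i)
    have a1 := hC₁ i t ht
    have a2 := hC₂ i t ht
    rw [iteratedDerivWithin_one] at a1
    rw [iteratedDerivWithin_succ, iteratedDerivWithin_one] at a2
    have b1 := le_abs_self (C₁ i)
    have b2 := le_abs_self (C₂ i)
    have b3 := abs_nonneg (C₁ i)
    have b4 := abs_nonneg (C₂ i)
    constructor <;> linarith
  · exact (((hC i).of_le (by norm_num)).mono (hsub τ hτ)).absolutelyContinuousOnInterval
  · exact ((hC' i).mono (hsub τ hτ)).absolutelyContinuousOnInterval

theorem exists_lipschitz_bound {g : Fin N → Profile N → Plane} (hg : ∀ i, ContDiff ℝ 2 (g i))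
    (z : Profile N) (ρ : ℝ) :
    ∃ C > 0, ∀ i, ∀ x ∈ Metric.closedBall z ρ, ‖fderiv ℝ (g i) x‖ ≤ C ∧
      ∀ y ∈ Metric.closedBall z ρ, ‖g i y - g i x‖ ≤ C * ‖y - x‖ := by
  have h : ∀ i, ∃ C, ∀ x ∈ Metric.closedBall z ρ, ‖fderiv ℝ (g i) x‖ ≤ C := fun i =>
    (isCompact_closedBall z ρ).exists_bound_of_continuousOn
      ((hg i).continuous_fderiv (by norm_num)).continuousOn
  choose C hC using h
  have hle : ∀ i, C i ≤ 1 + ∑ i, |C i| := fun i => by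
    have hs := Finset.single_le_sum (f := fun i => |C i|) (fun i _ => abs_nonneg _)
      (Finset.mem_univ i)
    have b1 := le_abs_self (C i)
    linarith
  refine ⟨1 + ∑ i, |C i|, by positivity, fun i x hx => ⟨(hC i x hx).trans (hle i), fun y hy => ?_⟩⟩
  exact Convex.norm_image_sub_le_of_norm_fderiv_le (𝕜 := ℝ)
    (fun x _ => ((hg i).differentiable (by norm_num)) x)
    (fun x hx => (hC i x hx).trans (hle i)) (convex_closedBall z ρ) hx hy

/-- The observer error, with the unmodelled terms evaluated at the observed positions. -/
noncomputable def observerErr (g : Fin N → Profile N → Plane) (d : Fin N → ℝ → Plane)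
    (ks : Fin N → ℝ) (t : ℝ) (s : State N) (i : Fin N) : Plane :=
  g i s.xh + d i t - s.zh i - ks i • s.ζ₁ i

section ClosedLoop

variable {G : ConnectivityGame N} {A : CommGraph N} {g : Fin N → Profile N → Plane}
  {d : Fin N → ℝ → Plane} {θ : ℝ} {θbar : Fin N → Fin N → ℝ} {ks c β : Fin N → ℝ} {xs : Profile N}
  {X : ℝ → State N} {t₀ τ : ℝ}

theorem IsSolutionOn.absolutelyContinuous_observerErr {P : Loop N} (hg : ∀ i, ContDiff ℝ 2 (g i))
    (hd : ∀ i, AbsolutelyContinuousOnInterval (d i) t₀ τ) (hX : IsSolutionOn P t₀ τ X) (i : Fin N) :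
    AbsolutelyContinuousOnInterval (fun t => observerErr g d ks t (X t) i) t₀ τ := by
  have hxh : AbsolutelyContinuousOnInterval (fun t => (X t).xh) t₀ τ :=
    AbsolutelyContinuousOnInterval.pi hX.ac_xh
  -- g is only locally Lipschitz, but the path stays in a ball.
  obtain ⟨ρ, hρ⟩ := hxh.exists_bound
  obtain ⟨C, -, hC⟩ := exists_lipschitz_bound hg 0 ρ
  have hgx : AbsolutelyContinuousOnInterval (fun t => g i (X t).xh) t₀ τ :=
    hxh.lipschitz_comp (K := C) (φ := g i) fun s hs t ht => by
      rw [dist_eq_norm, dist_eq_norm]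
      exact (hC i _ (mem_closedBall_zero_iff.2 (hρ t ht))).2 _ (mem_closedBall_zero_iff.2 (hρ s hs))
  exact ((hgx.fun_add (hd i)).fun_sub (hX.ac_zh i)).fun_sub
    (((hX.ac_x i).fun_sub (hX.ac_xh i)).const_smul (ks i))

/-- The closed loop in the error coordinates. -/
theorem IsSolutionOn.ae_error_dynamics (hg : ∀ i, ContDiff ℝ 2 (g i))
    (hxs : ∀ i, G.hess i xs + G.q i = 0)
    (hX : IsSolutionOn ⟨G.cost, A, g, d, ⟨θ, θbar, ks, c, β⟩⟩ t₀ τ X) (hτ : t₀ ≤ τ)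
    {d₁ : ℝ → Profile N} (hd : ∀ t, t₀ < t → ∀ i, HasDerivAt (d i) (d₁ t i) t) :
    ∀ᵐ t, t ∈ Set.Icc t₀ τ → t₀ < t ∧ ∃ (σ p' : Profile N) (q' : Fin N → Profile N),
      (∀ i k, σ i k ∈ SGN ((X t).ζ₁ i k)) ∧
      (∀ i, p' i = -G.hess i ((fun j => (X t).xh j - xs j) + fun j => (X t).y i j - (X t).xh j) +
        (ks i + c i) • (X t).ζ₁ i) ∧
      (∀ i j, q' i j = -((θ * θbar i j) •
        ((∑ k, A.a i k • (((X t).y i j - (X t).xh j) - ((X t).y k j - (X t).xh j))) +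
          A.a i j • (((X t).y i j - (X t).xh j) - (X t).ζ₁ j))) - p' j) ∧
      (∀ i, HasDerivAt (fun t => (X t).xh i - xs i) (p' i) t) ∧
      (∀ i j, HasDerivAt (fun t => (X t).y i j - (X t).xh j) (q' i j) t) ∧
      (∀ i, HasDerivAt (fun t => (X t).ζ₁ i) (observerErr g d ks t (X t) i +
        (g i (X t).x - g i (X t).xh) - c i • (X t).ζ₁ i) t) ∧
      (∀ i, HasDerivAt (fun t => observerErr g d ks t (X t) i)
        (fderiv ℝ (g i) (X t).xh p' + d₁ t i -
          ks i • (observerErr g d ks t (X t) i + (g i (X t).x - g i (X t).xh)) - β i • σ i) t) ∧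
      ∀ i k, DifferentiableAt ℝ (fun t => |(X t).ζ₁ i k|) t := by
  -- At t₀ the disturbance is only known to have a one-sided derivative.
  have hne : ∀ᵐ t : ℝ, t ≠ t₀ := compl_mem_ae_iff.2 (measure_singleton t₀)
  have hx := ae_all_iff.2 fun i => (ae_restrict_iff' measurableSet_Icc).1 (hX.eq_x i)
  have hy := ae_all_iff.2 fun i => ae_all_iff.2 fun j =>
    (ae_restrict_iff' measurableSet_Icc).1 (hX.eq_y i j)
  have hxh := ae_all_iff.2 fun i => (ae_restrict_iff' measurableSet_Icc).1 (hX.eq_xh i)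
  have hzh := ae_all_iff.2 fun i => (ae_restrict_iff' measurableSet_Icc).1 (hX.eq_zh i)
  have habs := ae_all_iff.2 fun i => ae_all_iff.2 fun k => (absolutelyContinuous_abs_apply
    ((hX.ac_x i).fun_sub (hX.ac_xh i)) k).ae_differentiableAt
  filter_upwards [hne, hx, hy, hxh, hzh, habs] with t hne hx hy hxh hzh habs ht
  have ht₀ : t₀ < t := lt_of_le_of_ne ht.1 hne.symm
  replace hx := fun i => hx i ht
  replace hy := fun i j => hy i j ht
  replace hxh := fun i => hxh i ht
  replace hzh := fun i => hzh i ht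
  replace habs := fun i k => habs i k (by rwa [Set.uIcc_of_le hτ])
  choose v hv hzh using hzh
  choose σ hσ hv using hv
  -- The Nash condition cancels the constant part of the affine gradient, leaving its linear part at
  -- yᵢ − x* = p + qᵢ.
  have hgrad : ∀ i, -ownGradient G.cost i ((X t).y i) = -G.hess i
      ((fun j => (X t).xh j - xs j) + fun j => (X t).y i j - (X t).xh j) := fun i => by
    have h1 : ((fun j => (X t).xh j - xs j) + fun j => (X t).y i j - (X t).xh j) =
        (X t).y i - xs := by
      funext j
      simp
    rw [G.ownGradient_cost, h1, map_sub, ← sub_eq_zero]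
    have h2 := hxs i
    have h3 : G.q i = -G.hess i xs := eq_neg_of_add_eq_zero_right h2
    rw [h3]
    abel
  have hp' : ∀ i, HasDerivAt (fun t => (X t).xh i)
      (-G.hess i ((fun j => (X t).xh j - xs j) + fun j => (X t).y i j - (X t).xh j) +
        (ks i + c i) • (X t).ζ₁ i) t := fun i => by
    refine (hxh i).congr_deriv ?_
    simp only [Loop.xhDot, Loop.u, State.ζ₁, hgrad]
    abel
  refine ⟨ht₀, σ, _, _, hσ, fun i => rfl, fun i j => rfl, fun i => (hp' i).sub_const _,
    fun i j => ?_, fun i => ?_, fun i => ?_, habs⟩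
  · refine ((hy i j).sub (hp' j)).congr_deriv ?_
    simp [Loop.yDot, State.ζ₁]
  · refine ((hx i).sub (hxh i)).congr_deriv ?_
    simp only [Loop.xDot, Loop.xhDot, Loop.u, State.ζ₁, observerErr]
    module
  · have hxh' : HasDerivAt (fun t => (X t).xh) _ t := hasDerivAt_pi.2 hp'
    have hgx := (((hg i).differentiable (by norm_num)) (X t).xh).hasFDerivAt.comp_hasDerivAt t hxh'
    refine (((hgx.add (hd t ht₀ i)).sub (hzh i)).sub
      (((hx i).sub (hxh i)).const_smul (ks i))).congr_deriv ?_
    rw [hv i]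
    simp only [Loop.xDot, Loop.xhDot, Loop.u, State.ζ₁, observerErr]
    module

end ClosedLoop

end SensorSeeking

/-! ### Comparison of the Lyapunov function with the error norm. -/

namespace SensorSeeking

variable {N : ℕ}

theorem lyapunov_components {u : Fin N → ℝ} {b : Fin N → Fin N → ℝ} {lam : ℝ} {β : Fin N → ℝ}
    {p : Profile N} {q : Fin N → Profile N} {e ψ d₁ : Profile N} {D₁ m₀ : ℝ} (hlam : 0 ≤ lam)
    (hβ : ∀ i, 0 < β i) (hD : ∀ i, 4 * D₁ ≤ β i) (hd : ∀ i, ‖d₁ i‖ ≤ D₁) (hm : 0 ≤ m₀)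
    (hu : ∀ i, m₀ ≤ u i) (hb : ∀ i j, m₀ ≤ b i j) :
    0 ≤ lyapunov u b lam β p q e ψ d₁ ∧
    (∀ i, m₀ * ‖p i‖ ^ 2 ≤ lyapunov u b lam β p q e ψ d₁) ∧
    (∀ i j, m₀ * ‖q i j‖ ^ 2 ≤ lyapunov u b lam β p q e ψ d₁) ∧
    (∀ i, lam * (1 / (2 * β i) * ‖ψ i‖ ^ 2) ≤ lyapunov u b lam β p q e ψ d₁) ∧
    ∀ i, lam * (1 / 2 * ‖e i‖) ≤ lyapunov u b lam β p q e ψ d₁ := by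
  have h := le_lyapunov (u := u) (b := b) (p := p) (q := q) (e := e) (ψ := ψ) hlam hβ hD hd
  have hu0 : ∀ i, 0 ≤ u i := fun i => hm.trans (hu i)
  have hb0 : ∀ i j, 0 ≤ b i j := fun i j => hm.trans (hb i j)
  have t1 : ∀ i, 0 ≤ u i * ‖p i‖ ^ 2 := fun i => mul_nonneg (hu0 i) (by positivity)
  have t2 : ∀ i j, 0 ≤ b i j * ‖q i j‖ ^ 2 := fun i j => mul_nonneg (hb0 i j) (by positivity)
  have t2' : ∀ i, 0 ≤ ∑ j, b i j * ‖q i j‖ ^ 2 := fun i => Finset.sum_nonneg fun j _ => t2 i j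
  have t3 : ∀ i, 0 ≤ 1 / (2 * β i) * ‖ψ i‖ ^ 2 := fun i => by
    have := hβ i
    positivity
  have t3' : ∀ i, 0 ≤ 1 / (2 * β i) * ‖ψ i‖ ^ 2 + 1 / 2 * ‖e i‖ := fun i =>
    add_nonneg (t3 i) (by positivity)
  have s1 := Finset.sum_nonneg fun i (_ : i ∈ Finset.univ) => t1 i
  have s2 := Finset.sum_nonneg fun i (_ : i ∈ Finset.univ) => t2' i
  have s3 := mul_nonneg hlam (Finset.sum_nonneg fun i (_ : i ∈ Finset.univ) => t3' i)
  have hmem : ∀ i : Fin N, i ∈ Finset.univ := Finset.mem_univ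
  refine ⟨by linarith, fun i => ?_, fun i j => ?_, fun i => ?_, fun i => ?_⟩
  · have h1 := Finset.single_le_sum (fun i _ => t1 i) (hmem i)
    have h2 := mul_le_mul_of_nonneg_right (hu i) (by positivity : 0 ≤ ‖p i‖ ^ 2)
    linarith
  · have h1 := Finset.single_le_sum (fun i _ => t2' i) (hmem i)
    have h2 := Finset.single_le_sum (fun j _ => t2 i j) (hmem j)
    have h3 := mul_le_mul_of_nonneg_right (hb i j) (by positivity : 0 ≤ ‖q i j‖ ^ 2)
    linarith
  · have h1 := mul_le_mul_of_nonneg_left (Finset.single_le_sum (fun i _ => t3' i) (hmem i)) hlam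
    have h2 : 0 ≤ lam * (1 / 2 * ‖e i‖) := by positivity
    linarith
  · have h1 := mul_le_mul_of_nonneg_left (Finset.single_le_sum (fun i _ => t3' i) (hmem i)) hlam
    have h2 := mul_nonneg hlam (t3 i)
    linarith

/-- The Lyapunov function as a function of the state of the closed loop. -/
noncomputable def loopLyapunov (u : Fin N → ℝ) (b : Fin N → Fin N → ℝ) (lam : ℝ) (β : Fin N → ℝ)
    (g : Fin N → Profile N → Plane) (d : Fin N → ℝ → Plane) (ks : Fin N → ℝ) (xs : Profile N)
    (d₁ : ℝ → Profile N) (t : ℝ) (s : State N) : ℝ :=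
  lyapunov u b lam β (fun j => s.xh j - xs j) (fun i j => s.y i j - s.xh j) (fun j => s.ζ₁ j)
    (fun j => observerErr g d ks t s j) (d₁ t)

theorem norm_sub_le_of_ball {g : Fin N → Profile N → Plane} {xs : Profile N} {ρ Cg r₁ r₂ : ℝ}
    (hCg0 : 0 ≤ Cg) (hr₁ : 0 ≤ r₁) (hr₂ : 0 ≤ r₂)
    (hCg : ∀ i, ∀ x ∈ Metric.closedBall xs ρ, ‖fderiv ℝ (g i) x‖ ≤ Cg ∧
      ∀ y ∈ Metric.closedBall xs ρ, ‖g i y - g i x‖ ≤ Cg * ‖y - x‖)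
    {s : State N} (hp : ∀ i, ‖s.xh i - xs i‖ ≤ r₁) (he : ∀ i, ‖s.ζ₁ i‖ ≤ r₂) (hρ : r₁ + r₂ ≤ ρ)
    (i : Fin N) : ‖fderiv ℝ (g i) s.xh‖ ≤ Cg ∧
      ‖g i s.x - g i s.xh‖ ≤ Cg * ∑ j, ‖s.ζ₁ j‖ := by
  have h1 : s.xh ∈ Metric.closedBall xs ρ := by
    rw [mem_closedBall_iff_norm, pi_norm_le_iff_of_nonneg (by linarith)]
    exact fun i => (hp i).trans (by linarith)
  have h2 : s.x ∈ Metric.closedBall xs ρ := by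
    rw [mem_closedBall_iff_norm, pi_norm_le_iff_of_nonneg (by linarith)]
    intro i
    have h : (s.x - xs) i = (s.xh i - xs i) + s.ζ₁ i := by
      simp only [State.ζ₁, Pi.sub_apply]
      abel
    rw [h]
    exact (norm_add_le _ _).trans ((add_le_add (hp i) (he i)).trans hρ)
  refine ⟨(hCg i _ h1).1, ((hCg i _ h1).2 _ h2).trans ?_⟩
  gcongr
  refine (pi_norm_le_iff_of_nonneg (Finset.sum_nonneg fun _ _ => norm_nonneg _)).2 fun i => ?_
  exact Finset.single_le_sum (f := fun j => ‖s.ζ₁ j‖) (fun j _ => norm_nonneg _)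
    (Finset.mem_univ i)

/-- γ differs from ψ by a difference of values of g only, so a bound on the initial γ bounds the
initial ψ with no gain appearing. -/
theorem Loop.γ_eq {G : ConnectivityGame N} {A : CommGraph N} {g : Fin N → Profile N → Plane}
    {d : Fin N → ℝ → Plane} {θ : ℝ} {θbar : Fin N → Fin N → ℝ} {ks c β : Fin N → ℝ} (t : ℝ)
    (s : State N) (i : Fin N) :
    Loop.γ ⟨G.cost, A, g, d, ⟨θ, θbar, ks, c, β⟩⟩ t s i =
      observerErr g d ks t s i + (g i s.x - g i s.xh) := by
  simp only [Loop.γ, Loop.xDot, Loop.xhDot, Loop.u, State.ζ₁, observerErr]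
  module

theorem Loop.ζ₂_eq {G : ConnectivityGame N} {A : CommGraph N} {g : Fin N → Profile N → Plane}
    {d : Fin N → ℝ → Plane} {θ : ℝ} {θbar : Fin N → Fin N → ℝ} {ks c β : Fin N → ℝ} (t : ℝ)
    (s : State N) (i : Fin N) :
    Loop.ζ₂ ⟨G.cost, A, g, d, ⟨θ, θbar, ks, c, β⟩⟩ t s i =
      observerErr g d ks t s i + (g i s.x - g i s.xh) + ks i • s.ζ₁ i := by
  simp only [Loop.ζ₂, Loop.z, State.ζ₁, observerErr]
  module

theorem Loop.norm_le_errNorm (P : Loop N) (xs : Profile N) (t : ℝ) (s : State N) :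
    (∀ i, ‖s.ζ₁ i‖ ≤ P.errNorm xs t s) ∧ (∀ i j, ‖s.η i j‖ ≤ P.errNorm xs t s) ∧
    (∀ i, ‖s.ξ xs i‖ ≤ P.errNorm xs t s) ∧ ∀ i, ‖P.γ t s i‖ ≤ P.errNorm xs t s := by
  have hn : ∀ f : Fin N → Plane, 0 ≤ ∑ i, ‖f i‖ ^ 2 := fun f =>
    Finset.sum_nonneg fun i _ => by positivity
  have hs : ∀ (f : Fin N → Plane) i, ‖f i‖ ^ 2 ≤ ∑ i, ‖f i‖ ^ 2 := fun f i =>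
    Finset.single_le_sum (f := fun i => ‖f i‖ ^ 2) (fun i _ => by positivity) (Finset.mem_univ i)
  have h1 := hn fun i => s.ζ₁ i
  have h2 := hn fun i => P.ζ₂ t s i
  have h3 : 0 ≤ ∑ i, ∑ j, ‖s.η i j‖ ^ 2 := Finset.sum_nonneg fun i _ => hn fun j => s.η i j
  have h4 := hn fun i => s.ξ xs i
  have h5 := hn fun i => P.γ t s i
  unfold Loop.errNorm
  refine ⟨fun i => Real.le_sqrt_of_sq_le ?_, fun i j => Real.le_sqrt_of_sq_le ?_,
    fun i => Real.le_sqrt_of_sq_le ?_, fun i => Real.le_sqrt_of_sq_le ?_⟩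
  · linarith [hs (fun i => s.ζ₁ i) i]
  · have h := Finset.single_le_sum (f := fun i => ∑ j, ‖s.η i j‖ ^ 2)
      (fun i _ => hn fun j => s.η i j) (Finset.mem_univ i)
    linarith [hs (fun j => s.η i j) j]
  · linarith [hs (fun i => s.ξ xs i) i]
  · linarith [hs (fun i => P.γ t s i) i]

theorem Loop.errNorm_sq_le {P : Loop N} {xs : Profile N} {t : ℝ} {s : State N} {L : ℝ}
    (h1 : ∀ i, ‖s.ζ₁ i‖ ^ 2 ≤ L) (h2 : ∀ i, ‖P.ζ₂ t s i‖ ^ 2 ≤ L)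
    (h3 : ∀ i j, ‖s.η i j‖ ^ 2 ≤ L) (h4 : ∀ i, ‖s.ξ xs i‖ ^ 2 ≤ L)
    (h5 : ∀ i, ‖P.γ t s i‖ ^ 2 ≤ L) : P.errNorm xs t s ≤ √((4 * N + N ^ 2) * L) := by
  unfold Loop.errNorm
  have hs : ∀ (f : Fin N → Plane), (∀ i, ‖f i‖ ^ 2 ≤ L) → ∑ i, ‖f i‖ ^ 2 ≤ N * L := fun f hf =>
    (Finset.sum_le_card_nsmul Finset.univ _ L fun i _ => hf i).trans_eq (by simp)
  have h3' : ∑ i, ∑ j, ‖s.η i j‖ ^ 2 ≤ N * (N * L) :=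
    (Finset.sum_le_card_nsmul Finset.univ _ (N * L) fun i _ => hs (fun j => s.η i j)
      (h3 i)).trans_eq (by simp)
  refine Real.sqrt_le_sqrt ?_
  linarith [hs _ h1, hs _ h2, hs _ h4, hs _ h5]

/-- V is linear in ‖e‖, so a bound of ‖e‖² by V needs ‖e‖ ≤ r, which holds on the sublevel set. The
constant may depend on all gains: it only transfers decay. -/
theorem exists_errNorm_bound {G : ConnectivityGame N} {A : CommGraph N}
    {g : Fin N → Profile N → Plane} {d : Fin N → ℝ → Plane} {θ : ℝ} {θbar : Fin N → Fin N → ℝ}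
    {ks c β u : Fin N → ℝ} {b : Fin N → Fin N → ℝ} {xs : Profile N} {d₁ : ℝ → Profile N}
    {lam D₁ m₀ R r ρ Cg : ℝ} (hlam : 0 < lam) (hβ : ∀ i, 0 < β i) (hD : ∀ i, 4 * D₁ ≤ β i)
    (hm : 0 < m₀) (hu : ∀ i, m₀ ≤ u i) (hb : ∀ i j, m₀ ≤ b i j) (hR : 0 ≤ R) (hr : 0 ≤ r)
    (hρ : R + r ≤ ρ) (hrR : 2 * (m₀ * R ^ 2) ≤ lam * r) (hCg0 : 0 ≤ Cg) (hks : ∀ i, 0 ≤ ks i)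
    (hCg : ∀ i, ∀ x ∈ Metric.closedBall xs ρ, ‖fderiv ℝ (g i) x‖ ≤ Cg ∧
      ∀ y ∈ Metric.closedBall xs ρ, ‖g i y - g i x‖ ≤ Cg * ‖y - x‖) :
    ∃ C ≥ 0, ∀ t s, (∀ i, ‖d₁ t i‖ ≤ D₁) →
      loopLyapunov u b lam β g d ks xs d₁ t s ≤ m₀ * R ^ 2 →
      Loop.errNorm ⟨G.cost, A, g, d, ⟨θ, θbar, ks, c, β⟩⟩ xs t s ≤
        √(C * loopLyapunov u b lam β g d ks xs d₁ t s) := by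
  have hK0 : 0 ≤ ∑ i, ks i := Finset.sum_nonneg fun i _ => hks i
  have hksK : ∀ i, ks i ≤ ∑ i, ks i := fun i =>
    Finset.single_le_sum (fun i _ => hks i) (Finset.mem_univ i)
  have hβ0 : 0 ≤ ∑ i, β i := Finset.sum_nonneg fun i _ => (hβ i).le
  have hβS : ∀ i, β i ≤ ∑ i, β i := fun i =>
    Finset.single_le_sum (fun i _ => (hβ i).le) (Finset.mem_univ i)
  set K := ∑ i, ks i
  set S := ∑ i, β i
  -- The summands bound, relative to V, the squares of p and q, of e, and of ψ.
  set k : ℝ := 1 / m₀ + 2 * r / lam + 2 * S / lam with hk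
  have hk1 : 1 / m₀ ≤ k := by
    have : 0 ≤ 2 * r / lam := by positivity
    have : 0 ≤ 2 * S / lam := by positivity
    linarith
  have hk2 : 2 * r / lam ≤ k := by
    have : 0 ≤ 1 / m₀ := by positivity
    have : 0 ≤ 2 * S / lam := by positivity
    linarith
  have hk3 : 2 * S / lam ≤ k := by
    have : 0 ≤ 1 / m₀ := by positivity
    have : 0 ≤ 2 * r / lam := by positivity
    linarith
  have hk0 : 0 ≤ k := le_trans (by positivity) hk1
  clear_value k K S
  refine ⟨(4 * N + N ^ 2) * ((2 + N * Cg + K) ^ 2 * k), by positivity, fun t s hd hV => ?_⟩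
  obtain ⟨hV0, hp, hq, hψ, he⟩ := lyapunov_components (p := fun j => s.xh j - xs j)
    (q := fun i j => s.y i j - s.xh j) (e := fun j => s.ζ₁ j)
    (ψ := fun j => observerErr g d ks t s j) hlam.le hβ hD hd hm.le hu hb
  change ∀ i, m₀ * ‖s.xh i - xs i‖ ^ 2 ≤ loopLyapunov u b lam β g d ks xs d₁ t s at hp
  change ∀ i j, m₀ * ‖s.y i j - s.xh j‖ ^ 2 ≤ loopLyapunov u b lam β g d ks xs d₁ t s at hq
  change ∀ i, lam * (1 / (2 * β i) * ‖observerErr g d ks t s i‖ ^ 2) ≤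
    loopLyapunov u b lam β g d ks xs d₁ t s at hψ
  change ∀ i, lam * (1 / 2 * ‖s.ζ₁ i‖) ≤ loopLyapunov u b lam β g d ks xs d₁ t s at he
  change 0 ≤ loopLyapunov u b lam β g d ks xs d₁ t s at hV0
  generalize loopLyapunov u b lam β g d ks xs d₁ t s = V at *
  have hpR : ∀ i, ‖s.xh i - xs i‖ ≤ R := fun i => by
    refine le_of_sq_le_sq ?_ hR
    exact le_of_mul_le_mul_left ((hp i).trans hV) hm
  have her : ∀ i, ‖s.ζ₁ i‖ ≤ r := fun i => by
    refine le_of_mul_le_mul_left ?_ hlam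
    linarith [he i]
  set w := √(k * V) with hw
  have hw0 : 0 ≤ w := Real.sqrt_nonneg _
  have hw2 : w ^ 2 = k * V := Real.sq_sqrt (by positivity)
  have np : ∀ i, ‖s.xh i - xs i‖ ≤ w := fun i => Real.le_sqrt_of_sq_le <| by
    have h1 : ‖s.xh i - xs i‖ ^ 2 ≤ 1 / m₀ * V := by
      rw [one_div_mul_eq_div, le_div_iff₀ hm]
      linarith [hp i]
    exact h1.trans (by gcongr)
  have nq : ∀ i j, ‖s.y i j - s.xh j‖ ≤ w := fun i j => Real.le_sqrt_of_sq_le <| by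
    have h1 : ‖s.y i j - s.xh j‖ ^ 2 ≤ 1 / m₀ * V := by
      rw [one_div_mul_eq_div, le_div_iff₀ hm]
      linarith [hq i j]
    exact h1.trans (by gcongr)
  have nψ : ∀ i, ‖observerErr g d ks t s i‖ ≤ w := fun i => Real.le_sqrt_of_sq_le <| by
    have h1 : ‖observerErr g d ks t s i‖ ^ 2 ≤ 2 * S / lam * V := by
      rw [div_mul_eq_mul_div, le_div_iff₀ hlam]
      have h2 := mul_le_mul_of_nonneg_left (hψ i) (by linarith [hβ i] : 0 ≤ 2 * β i)
      have h3 : 2 * β i * (lam * (1 / (2 * β i) * ‖observerErr g d ks t s i‖ ^ 2)) =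
          ‖observerErr g d ks t s i‖ ^ 2 * lam := by
        have := (hβ i).ne'
        field_simp
      rw [h3] at h2
      exact h2.trans (by have := hβS i; gcongr)
    exact h1.trans (by gcongr)
  have ne : ∀ i, ‖s.ζ₁ i‖ ≤ w := fun i => Real.le_sqrt_of_sq_le <| by
    have h1 : ‖s.ζ₁ i‖ ^ 2 ≤ 2 * r / lam * V := by
      rw [div_mul_eq_mul_div, le_div_iff₀ hlam]
      have h2 := mul_le_mul_of_nonneg_right (her i) (norm_nonneg (s.ζ₁ i))
      have h3 := mul_le_mul_of_nonneg_right h2 hlam.le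
      have h4 := mul_le_mul_of_nonneg_left (he i) (by linarith : 0 ≤ 2 * r)
      linarith
    exact h1.trans (by gcongr)
  have nΔ : ∀ i, ‖g i s.x - g i s.xh‖ ≤ N * Cg * w := fun i => by
    refine ((norm_sub_le_of_ball hCg0 hR hr hCg hpR her hρ) i).2.trans ?_
    have h1 : ∑ j, ‖s.ζ₁ j‖ ≤ N * w :=
      (Finset.sum_le_card_nsmul Finset.univ _ w fun i _ => ne i).trans_eq (by simp)
    calc Cg * ∑ j, ‖s.ζ₁ j‖ ≤ Cg * (N * w) := by gcongr
      _ = N * Cg * w := by ring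
  have hNC : 0 ≤ N * Cg * w := by positivity
  have hKw : 0 ≤ K * w := by positivity
  have hfin : ∀ x : Plane, ‖x‖ ≤ (2 + N * Cg + K) * w → ‖x‖ ^ 2 ≤ (2 + N * Cg + K) ^ 2 * k * V :=
    fun x hx => by
      calc ‖x‖ ^ 2 ≤ ((2 + N * Cg + K) * w) ^ 2 := by gcongr
        _ = _ := by rw [mul_pow, hw2]; ring
  have hγ : ∀ i, ‖observerErr g d ks t s i + (g i s.x - g i s.xh)‖ ≤ w + N * Cg * w := fun i =>
    (norm_add_le _ _).trans (add_le_add (nψ i) (nΔ i))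
  rw [mul_assoc]
  refine Loop.errNorm_sq_le (fun i => hfin _ ?_) (fun i => hfin _ ?_) (fun i j => hfin _ ?_)
    (fun i => hfin _ ?_) (fun i => hfin _ ?_)
  · linarith [ne i]
  · rw [Loop.ζ₂_eq]
    refine (norm_add_le _ _).trans ?_
    rw [norm_smul, Real.norm_of_nonneg (hks i)]
    have h1 : ks i * ‖s.ζ₁ i‖ ≤ K * w := mul_le_mul (hksK i) (ne i) (norm_nonneg _) hK0
    linarith [hγ i]
  · have h1 : s.η i j = (s.y i j - s.xh j) - s.ζ₁ j := by simp [State.η, State.ζ₁]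
    rw [h1]
    refine (norm_sub_le _ _).trans ?_
    linarith [nq i j, ne j]
  · have h1 : s.ξ xs i = (s.xh i - xs i) + s.ζ₁ i := by simp [State.ξ, State.ζ₁]
    rw [h1]
    refine (norm_add_le _ _).trans ?_
    linarith [np i, ne i]
  · rw [Loop.γ_eq]
    linarith [hγ i]

end SensorSeeking

/-! ### Decay along solutions and the initial level. -/

namespace SensorSeeking

variable {N : ℕ}

section Decay

variable {G : ConnectivityGame N} {A : CommGraph N} {g : Fin N → Profile N → Plane}
  {d : Fin N → ℝ → Plane} {θ : ℝ} {θbar : Fin N → Fin N → ℝ} {ks c β u : Fin N → ℝ}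
  {xs : Profile N} {X : ℝ → State N} {t₀ τ lam : ℝ} {d₁ : ℝ → Profile N}

theorem IsSolutionOn.absolutelyContinuous_loopLyapunov {P : Loop N} {b : Fin N → Fin N → ℝ}
    (hg : ∀ i, ContDiff ℝ 2 (g i))
    (hd : ∀ i, AbsolutelyContinuousOnInterval (d i) t₀ τ ∧
      AbsolutelyContinuousOnInterval (fun t => d₁ t i) t₀ τ) (hX : IsSolutionOn P t₀ τ X) :
    AbsolutelyContinuousOnInterval
      (fun t => loopLyapunov u b lam β g d ks xs d₁ t (X t)) t₀ τ :=
  absolutelyContinuous_lyapunov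
    (fun i => (hX.ac_xh i).fun_sub
      (LipschitzWith.const (xs i)).lipschitzOnWith.absolutelyContinuousOnInterval)
    (fun i j => (hX.ac_y i j).fun_sub (hX.ac_xh j))
    (fun i => (hX.ac_x i).fun_sub (hX.ac_xh i))
    (fun i => hX.absolutelyContinuous_observerErr hg (fun i => (hd i).1) i)
    (fun i => (hd i).2)

/-- The level m₀R² is exactly what makes ‖p‖, ‖q‖ ≤ R and ‖e‖ ≤ r available, hence the formation,
drift and Lipschitz bounds. -/
theorem IsSolutionOn.ae_loopLyapunov_decay {d₂ : ℝ → Profile N}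
    {D C R r ρ Cg M U B m₀ : ℝ} (hg : ∀ i, ContDiff ℝ 2 (g i)) (hxs : ∀ i, G.hess i xs + G.q i = 0)
    (hX : IsSolutionOn ⟨G.cost, A, g, d, ⟨θ, θbar, ks, c, β⟩⟩ t₀ τ X) (hτ : t₀ ≤ τ)
    (hd : ∀ t, t₀ < t → ∀ i, HasDerivAt (d i) (d₁ t i) t ∧ HasDerivAt (fun t => d₁ t i) (d₂ t i) t)
    (hdD : ∀ t, t₀ ≤ t → ∀ i, ‖d₁ t i‖ ≤ D ∧ ‖d₂ t i‖ ≤ D)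
    (hform : ∀ (κ : Fin N → ℝ), (∀ i, 0 ≤ κ i) →
      ∀ (p : Profile N) (q : Fin N → Profile N) (e p' : Profile N) (q' : Fin N → Profile N),
      (∀ i, ‖p i‖ ≤ R) → (∀ i j, ‖q i j‖ ≤ R) →
      (∀ i, p' i = -G.hess i (p + q i) + κ i • e i) →
      (∀ i j, q' i j = -((θ * θbar i j) •
        ((∑ k, A.a i k • (q i j - q k j)) + A.a i j • (q i j - e j))) - p' j) →
      ∑ i, 2 * u i * inner ℝ (p i) (p' i) + ∑ i, ∑ j, 2 * (θbar i j)⁻¹ * inner ℝ (q i j) (q' i j) ≤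
        -(∑ i, ‖p i‖ ^ 2) - (∑ i, ∑ j, ‖q i j‖ ^ 2) + R * C * ∑ j, (θ + κ j) * ‖e j‖)
    (hdrift : ∀ (p : Profile N) (q : Fin N → Profile N) (e p' w Δ : Profile N), (∀ i, ‖e i‖ ≤ r) →
      (∀ i, p' i = -G.hess i (p + q i) + (ks i + c i) • e i) → (∀ i, ‖w i‖ ≤ Cg * ‖p'‖) →
      (∀ i, ‖Δ i‖ ≤ Cg * ∑ j, ‖e j‖) →
      ∀ i, ‖w i - ks i • Δ i‖ ^ 2 ≤
        M * (∑ i, ‖p i‖ ^ 2 + ∑ i, ∑ j, ‖q i j‖ ^ 2 + ∑ i, ‖e i‖))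
    (hCg0 : 0 ≤ Cg) (hCg : ∀ i, ∀ x ∈ Metric.closedBall xs ρ, ‖fderiv ℝ (g i) x‖ ≤ Cg ∧
      ∀ y ∈ Metric.closedBall xs ρ, ‖g i y - g i x‖ ≤ Cg * ‖y - x‖)
    (hC : 0 < C) (hR : 0 < R) (hr : 0 ≤ r) (hρ : R + r ≤ ρ) (hlam : lam = 16 * R * C)
    (hrR : 2 * (m₀ * R ^ 2) ≤ lam * r) (hm : 0 < m₀) (hu : ∀ i, m₀ ≤ u i ∧ u i ≤ U)
    (hb : ∀ i j, m₀ ≤ (θbar i j)⁻¹ ∧ (θbar i j)⁻¹ ≤ B) (hU : 0 ≤ U) (hB : 0 ≤ B)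
    (hks : ∀ i, 1 ≤ ks i) (hc1 : ∀ i, 1 ≤ c i) (hcθ : ∀ i, θ + ks i ≤ c i)
    (hcg : ∀ i, 8 * (N * (1 + 3 * Cg)) ≤ c i) (hβ : ∀ i, 0 < β i) (hβD : ∀ i, 4 * D ≤ β i)
    (hβM : ∀ i, M * (2 * lam * N + 1) ≤ β i) :
    ∀ᵐ t, t ∈ Set.Icc t₀ τ →
      loopLyapunov u (fun i j => (θbar i j)⁻¹) lam β g d ks xs d₁ t (X t) ≤ m₀ * R ^ 2 →
      ∃ V', HasDerivAt
        (fun t => loopLyapunov u (fun i j => (θbar i j)⁻¹) lam β g d ks xs d₁ t (X t)) V' t ∧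
        V' ≤ -(1 / (12 + 2 * U + 2 * B)) *
          loopLyapunov u (fun i j => (θbar i j)⁻¹) lam β g d ks xs d₁ t (X t) := by
  have hlam0 : 0 < lam := by rw [hlam]; positivity
  filter_upwards [hX.ae_error_dynamics hg hxs hτ fun t ht i => (hd t ht i).1] with t hdyn ht hV
  obtain ⟨ht₀, σ, p', q', hσ, hp', hq', dp, dq, de, dψ, habs⟩ := hdyn ht
  refine ⟨_, hasDerivAt_lyapunov hβ dp dq de dψ (fun i => (hd t ht₀ i).2) habs hσ, ?_⟩
  have hdt := hdD t ht.1
  obtain ⟨hV0, hp, hq, hψ, he⟩ := lyapunov_components (p := fun j => (X t).xh j - xs j)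
    (q := fun i j => (X t).y i j - (X t).xh j) (e := fun j => (X t).ζ₁ j)
    (ψ := fun j => observerErr g d ks t (X t) j) hlam0.le hβ hβD (fun i => (hdt i).1) hm.le
    (fun i => (hu i).1) (fun i j => (hb i j).1)
  have hpR : ∀ i, ‖(X t).xh i - xs i‖ ≤ R := fun i => by
    refine le_of_sq_le_sq ?_ hR.le
    exact le_of_mul_le_mul_left ((hp i).trans hV) hm
  have hqR : ∀ i j, ‖(X t).y i j - (X t).xh j‖ ≤ R := fun i j => by
    refine le_of_sq_le_sq ?_ hR.le
    exact le_of_mul_le_mul_left ((hq i j).trans hV) hm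
  have her : ∀ i, ‖(X t).ζ₁ i‖ ≤ r := fun i => by
    refine le_of_mul_le_mul_left ?_ hlam0
    have h := (he i).trans hV
    linarith
  have hball := norm_sub_le_of_ball hCg0 hR.le hr hCg hpR her hρ
  have hw : ∀ i, ‖fderiv ℝ (g i) (X t).xh p'‖ ≤ Cg * ‖p'‖ := fun i =>
    (ContinuousLinearMap.le_opNorm _ _).trans
      (mul_le_mul_of_nonneg_right (hball i).1 (norm_nonneg _))
  have hdr := hdrift (fun j => (X t).xh j - xs j) (fun i j => (X t).y i j - (X t).xh j)
    (fun j => (X t).ζ₁ j) p' (fun i => fderiv ℝ (g i) (X t).xh p')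
    (fun i => g i (X t).x - g i (X t).xh) her hp' hw fun i => (hball i).2
  have hW0 : 0 ≤ ∑ i, ‖(X t).xh i - xs i‖ ^ 2 + ∑ i, ∑ j, ‖(X t).y i j - (X t).xh j‖ ^ 2 +
      ∑ i, ‖(X t).ζ₁ i‖ := by positivity
  -- This ε gives λNε ≤ 1/2; the bound β ≥ M(2λN + 1) brings the drift below it.
  refine lyapunov_decay (θ := θ) (C := C) (R := R) (U := U) (B := B) (Cg := Cg) (D₁ := D)
    (D₂ := D) (c := c) (ε := 1 / (2 * lam * N + 1))
    (Δ := fun i => ‖g i (X t).x - g i (X t).xh‖)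
    (Z := fun i => ‖fderiv ℝ (g i) (X t).xh p' - ks i • (g i (X t).x - g i (X t).xh)‖ ^ 2 /
      (2 * ks i * β i)) hlam hC.le hR.le hβ hks (fun i => (hu i).2) (fun i j => (hb i j).2) hU hB
    hβD hβD (fun i => (hdt i).1) hc1 hcθ hcg ?_ ?_
    (hform (fun i => ks i + c i) (fun i => by linarith [hks i, hc1 i])
      (fun j => (X t).xh j - xs j) (fun i j => (X t).y i j - (X t).xh j)
      (fun j => (X t).ζ₁ j) p' q' hpR hqR hp' hq') (fun i => ?_) (fun i => ?_)
    (fun i => norm_nonneg _) fun i => (hball i).2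
  · rw [div_le_one (by positivity)]
    have : 0 ≤ 2 * lam * N := by positivity
    linarith
  · rw [mul_one_div, div_le_div_iff₀ (by positivity) (by norm_num)]
    linarith
  · refine observer_estimate (hβ i) (by linarith [hks i]) (by linarith [hc1 i]) _ _ _ _ _ _ _
      (norm_le_two_of_mem_SGN (hσ i)) ?_ (hdt i).1 (hdt i).2
    rw [inner_eq_l1_of_mem_SGN (hσ i)]
    exact norm_le_l1 _
  · have hbi := hβ i
    have hki := hks i
    rw [one_div_mul_eq_div, div_le_div_iff₀ (by positivity) (by positivity)]
    have hL : 0 ≤ 2 * lam * N + 1 := by positivity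
    have h1 := mul_le_mul_of_nonneg_right (hdr i) hL
    have h2 := mul_le_mul_of_nonneg_right (hβM i) hW0
    have h3 : β i ≤ 2 * ks i * β i := by nlinarith
    have h4 := mul_le_mul_of_nonneg_right h3 hW0
    linarith

/-- ‖ψ‖² enters divided by β, and β exceeds its initial size. The bound is therefore free of kˢ, c
and β, and R can be fixed before c and β. -/
theorem loopLyapunov_initial_le {b : Fin N → Fin N → ℝ} {D v₁ r₀ Cg U B : ℝ} {t : ℝ} {s : State N}
    (hCg0 : 0 ≤ Cg) (hv : 0 ≤ v₁) (hlam : 0 ≤ lam)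
    (hCg : ∀ i, ∀ x ∈ Metric.closedBall xs r₀, ‖fderiv ℝ (g i) x‖ ≤ Cg ∧
      ∀ y ∈ Metric.closedBall xs r₀, ‖g i y - g i x‖ ≤ Cg * ‖y - x‖) (hr₀ : 3 * v₁ ≤ r₀)
    (hu : ∀ i, u i ≤ U) (hb : ∀ i j, b i j ≤ B) (hU : 0 ≤ U) (hB : 0 ≤ B) (hβ : ∀ i, 0 < β i)
    (hβD : ∀ i, 4 * D ≤ β i) (hβv : ∀ i, (v₁ + Cg * (N * v₁)) ^ 2 ≤ β i)
    (hd : ∀ i, ‖d₁ t i‖ ≤ D)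
    (herr : Loop.errNorm ⟨G.cost, A, g, d, ⟨θ, θbar, ks, c, β⟩⟩ xs t s ≤ v₁) :
    loopLyapunov u b lam β g d ks xs d₁ t s ≤
      4 * v₁ ^ 2 * (N * U + N ^ 2 * B) + lam * (N * (1 + 3 * v₁)) := by
  obtain ⟨h1, h2, h3, h4⟩ := Loop.norm_le_errNorm ⟨G.cost, A, g, d, ⟨θ, θbar, ks, c, β⟩⟩ xs t s
  have he : ∀ i, ‖s.ζ₁ i‖ ≤ v₁ := fun i => (h1 i).trans herr
  have hp : ∀ i, ‖s.xh i - xs i‖ ≤ 2 * v₁ := fun i => by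
    have e1 : s.xh i - xs i = s.ξ xs i - s.ζ₁ i := by simp [State.ξ, State.ζ₁]
    rw [e1]
    refine (norm_sub_le _ _).trans ?_
    linarith [he i, (h3 i).trans herr]
  have hq : ∀ i j, ‖s.y i j - s.xh j‖ ≤ 2 * v₁ := fun i j => by
    have e1 : s.y i j - s.xh j = s.η i j + s.ζ₁ j := by simp [State.η, State.ζ₁]
    rw [e1]
    refine (norm_add_le _ _).trans ?_
    linarith [he j, (h2 i j).trans herr]
  have hΔ : ∀ i, ‖g i s.x - g i s.xh‖ ≤ Cg * (N * v₁) := fun i => by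
    refine (norm_sub_le_of_ball hCg0 (by linarith) hv hCg hp he (by linarith) i).2.trans ?_
    gcongr
    exact (Finset.sum_le_card_nsmul Finset.univ _ v₁ fun i _ => he i).trans_eq (by simp)
  have hψ : ∀ i, ‖observerErr g d ks t s i‖ ≤ v₁ + Cg * (N * v₁) := fun i => by
    have e1 : observerErr g d ks t s i =
        Loop.γ ⟨G.cost, A, g, d, ⟨θ, θbar, ks, c, β⟩⟩ t s i - (g i s.x - g i s.xh) := by
      rw [Loop.γ_eq, add_sub_cancel_right]
    rw [e1]
    refine (norm_sub_le _ _).trans ?_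
    linarith [hΔ i, (h4 i).trans herr]
  refine (lyapunov_le hlam hβ hβD hd).trans ?_
  have hsum : ∀ (f : Fin N → ℝ) (K : ℝ), (∀ i, f i ≤ K) → ∑ i, f i ≤ N * K := fun f K hf =>
    (Finset.sum_le_card_nsmul Finset.univ f K fun i _ => hf i).trans_eq (by simp)
  have s1 : ∑ i, u i * ‖s.xh i - xs i‖ ^ 2 ≤ N * (U * (2 * v₁) ^ 2) := hsum _ _ fun i => by
    have a1 := hu i
    have a2 := hp i
    gcongr
  have s2 : ∑ i, ∑ j, b i j * ‖s.y i j - s.xh j‖ ^ 2 ≤ N * (N * (B * (2 * v₁) ^ 2)) :=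
    hsum _ _ fun i => hsum _ _ fun j => by
      have a1 := hb i j
      have a2 := hq i j
      gcongr
  have s3 : ∑ i, (1 / (2 * β i) * ‖observerErr g d ks t s i‖ ^ 2 + 3 * ‖s.ζ₁ i‖) ≤
      N * (1 + 3 * v₁) := hsum _ _ fun i => by
    have a1 := he i
    have a2 : ‖observerErr g d ks t s i‖ ^ 2 ≤ β i := by
      have := hψ i
      exact le_trans (by gcongr) (hβv i)
    have a3 : 1 / (2 * β i) * ‖observerErr g d ks t s i‖ ^ 2 ≤ 1 := by
      have := hβ i
      rw [one_div_mul_eq_div, div_le_one (by positivity)]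
      linarith
    linarith
  have s4 := mul_le_mul_of_nonneg_left s3 hlam
  linarith

end Decay

theorem exists_uniform_bounds {ι : Type*} [Finite ι] {f : ι → ℝ} (hf : ∀ i, 0 < f i) :
    ∃ m > 0, ∃ M > 0, ∀ i, m ≤ f i ∧ f i ≤ M := by
  cases nonempty_fintype ι
  have h1 : ∀ i, 0 < (f i)⁻¹ := fun i => inv_pos.2 (hf i)
  have s1 : 0 ≤ ∑ i, (f i)⁻¹ := Finset.sum_nonneg fun i _ => (h1 i).le
  have s2 : 0 ≤ ∑ i, f i := Finset.sum_nonneg fun i _ => (hf i).le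
  refine ⟨(1 + ∑ i, (f i)⁻¹)⁻¹, by positivity, 1 + ∑ i, f i, by positivity, fun i => ⟨?_, ?_⟩⟩
  · refine inv_le_of_inv_le₀ (hf i) ?_
    linarith [Finset.single_le_sum (fun i _ => (h1 i).le) (Finset.mem_univ i)]
  · linarith [Finset.single_le_sum (fun i _ => (hf i).le) (Finset.mem_univ i)]

end SensorSeeking

/-! ### Choice of the gains and conclusion. -/

theorem corollary3 (N : ℕ) (hN : 2 ≤ N) (G : ConnectivityGame N) (A : CommGraph N)
    (g : Fin N → Profile N → Plane) (hg : ∀ i, ContDiff ℝ 2 (g i))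
    (t₀ : ℝ) (d : Fin N → ℝ → Plane) (hd : AdmissibleDisturbance t₀ d)
    (θbar : Fin N → Fin N → ℝ) (hθbar : ∀ i j, 0 < θbar i j) :
    (∃! xs : Profile N, IsNash G.cost xs) ∧
    ∀ xs : Profile N, IsNash G.cost xs →
    ∀ v₁ : ℝ, 0 < v₁ →
    ∃ θstar : ℝ, 0 < θstar ∧ ∀ θ : ℝ, θstar < θ →
    ∃ kr : ℝ, 0 < kr ∧ ∀ ks : Fin N → ℝ, (∀ i, kr < ks i) →
    ∃ cr : ℝ, 0 < cr ∧ ∀ c : Fin N → ℝ, (∀ i, cr < c i) →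
    ∃ βr : ℝ, 0 < βr ∧ ∀ β : Fin N → ℝ, (∀ i, βr < β i) →
    ∀ P : Loop N, P = ⟨G.cost, A, g, d, ⟨θ, θbar, ks, c, β⟩⟩ →
      -- no finite escape: solutions, on whatever interval they live, are uniformly bounded
      (∃ B : ℝ, ∀ (X : ℝ → State N) (τ : ℝ), t₀ ≤ τ → IsSolutionOn P t₀ τ X →
        P.errNorm xs t₀ (X t₀) ≤ v₁ → ∀ t ∈ Set.Icc t₀ τ, P.errNorm xs t (X t) ≤ B) ∧
      -- convergence of the errors, and of the positions to the Nash equilibrium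
      (∀ X : ℝ → State N, (∀ τ, t₀ ≤ τ → IsSolutionOn P t₀ τ X) →
        P.errNorm xs t₀ (X t₀) ≤ v₁ →
        Tendsto (fun t => P.errNorm xs t (X t)) atTop (𝓝 0) ∧
        ∀ i, Tendsto (fun t => (X t).x i) atTop (𝓝 (xs i))) := by
  refine ⟨G.existsUnique_isNash, fun xs hnash v₁ hv₁ => ?_⟩
  have hxs := (G.isNash_iff xs).1 hnash
  obtain ⟨u, hu, hcoer⟩ := G.exists_weights
  obtain ⟨θ₀, hθ₀, C, hC, hform⟩ := exists_formation_estimate G A hN θbar hθbar u hu hcoer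
  obtain ⟨d₁, d₂, D, hD, hdd, hdD, hdac⟩ := hd.exists_derivs
  obtain ⟨mu, hmu, U, hU, huU⟩ := exists_uniform_bounds hu
  obtain ⟨mb, hmb, B, hB, hbB⟩ := exists_uniform_bounds
    (f := fun ij : Fin N × Fin N => (θbar ij.1 ij.2)⁻¹) fun ij => inv_pos.2 (hθbar _ _)
  obtain ⟨m₀, hm₀, hm₀u, hm₀b⟩ : ∃ m₀ > 0, m₀ ≤ mu ∧ m₀ ≤ mb :=
    ⟨min mu mb, lt_min hmu hmb, min_le_left _ _, min_le_right _ _⟩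
  refine ⟨θ₀, hθ₀, fun θ hθ => ⟨1, one_pos, fun ks hks => ?_⟩⟩
  have hθ0 : 0 < θ := hθ₀.trans hθ
  -- With λ = 16RC the initial bound is affine in R, so the quadratic m₀R² overtakes it.
  obtain ⟨R, hR1, hRV⟩ : ∃ R : ℝ, 1 ≤ R ∧
      4 * v₁ ^ 2 * (N * U + N ^ 2 * B) + 16 * R * C * (N * (1 + 3 * v₁)) < m₀ * R ^ 2 := by
    have ha : 0 ≤ 4 * v₁ ^ 2 * (N * U + N ^ 2 * B) := by positivity
    have hb : 0 ≤ 16 * C * (N * (1 + 3 * v₁)) := by positivity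
    set a := 4 * v₁ ^ 2 * (N * U + N ^ 2 * B)
    set b := 16 * C * (N * (1 + 3 * v₁)) with hbdef
    have hR : 1 ≤ 1 + (a + b) / m₀ := by
      have : 0 ≤ (a + b) / m₀ := by positivity
      linarith
    refine ⟨1 + (a + b) / m₀, hR, ?_⟩
    have e1 : m₀ * (1 + (a + b) / m₀) = m₀ + a + b := by field_simp; ring
    generalize 1 + (a + b) / m₀ = R at hR e1
    have e2 : 16 * R * C * (N * (1 + 3 * v₁)) = b * R := by rw [hbdef]; ring
    rw [e2, sq, ← mul_assoc, e1]
    nlinarith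
  have hR0 : 0 < R := by linarith
  obtain ⟨lam, hlam⟩ : ∃ lam, lam = 16 * R * C := ⟨_, rfl⟩
  have hlam0 : 0 < lam := by rw [hlam]; positivity
  rw [← hlam] at hRV
  obtain ⟨r, hr0, hrR⟩ : ∃ r, 0 ≤ r ∧ 2 * (m₀ * R ^ 2) ≤ lam * r :=
    ⟨2 * (m₀ * R ^ 2) / lam, by positivity, by rw [mul_div_cancel₀ _ hlam0.ne']⟩
  -- The radius covers x and x̂ on the sublevel set (R + r) and at the initial time (3v₁).
  obtain ⟨Cg, hCg0, hCg⟩ := exists_lipschitz_bound hg xs (R + r + 3 * v₁)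
  have hks0 : ∀ i, 0 ≤ ks i := fun i => by linarith [hks i]
  have hksS : ∀ i, ks i ≤ ∑ i, ks i := fun i =>
    Finset.single_le_sum (fun i _ => hks0 i) (Finset.mem_univ i)
  have hksS0 : 0 ≤ ∑ i, ks i := Finset.sum_nonneg fun i _ => hks0 i
  have hNCg : 0 ≤ 8 * (N * (1 + 3 * Cg)) := by positivity
  -- c must dominate θ + kˢ in the formation error and the Lipschitz terms of g.
  refine ⟨1 + θ + ∑ i, ks i + 8 * (N * (1 + 3 * Cg)), by positivity, fun c hc => ?_⟩
  have hc1 : ∀ i, 1 ≤ c i := fun i => by linarith [hc i]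
  have hcθ : ∀ i, θ + ks i ≤ c i := fun i => by linarith [hc i, hksS i]
  have hcg : ∀ i, 8 * (N * (1 + 3 * Cg)) ≤ c i := fun i => by linarith [hc i]
  have hkc0 : ∀ i, 0 ≤ ks i + c i := fun i => by linarith [hks0 i, hc1 i]
  have hkcS : ∀ i, ks i + c i ≤ ∑ i, (ks i + c i) := fun i =>
    Finset.single_le_sum (f := fun i => ks i + c i) (fun i _ => hkc0 i) (Finset.mem_univ i)
  obtain ⟨M, hM, hdrift⟩ := exists_drift_bound G (Cg := Cg) (K := ∑ i, (ks i + c i)) (r := r)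
    (Finset.sum_nonneg fun i _ => hkc0 i) hr0
  -- The summands control the disturbance correction, the drift and the initial ψ. M depends on kˢ
  -- and c, so β comes last.
  refine ⟨4 * D + M * (2 * lam * N + 1) + (v₁ + Cg * (N * v₁)) ^ 2, by positivity, fun β hβr => ?_⟩
  have hM0 : 0 ≤ M * (2 * lam * N + 1) := by positivity
  have hv0 : 0 ≤ (v₁ + Cg * (N * v₁)) ^ 2 := by positivity
  have hβD : ∀ i, 4 * D ≤ β i := fun i => by linarith [hβr i]
  have hβM : ∀ i, M * (2 * lam * N + 1) ≤ β i := fun i => by linarith [hβr i]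
  have hβv : ∀ i, (v₁ + Cg * (N * v₁)) ^ 2 ≤ β i := fun i => by linarith [hβr i]
  have hβ : ∀ i, 0 < β i := fun i => by linarith [hβD i]
  rintro P rfl
  have huU' : ∀ i, m₀ ≤ u i ∧ u i ≤ U := fun i => ⟨hm₀u.trans (huU i).1, (huU i).2⟩
  have hbB' : ∀ i j, m₀ ≤ (θbar i j)⁻¹ ∧ (θbar i j)⁻¹ ≤ B := fun i j =>
    ⟨hm₀b.trans (hbB (i, j)).1, (hbB (i, j)).2⟩
  obtain ⟨L, hL0, hL⟩ := exists_errNorm_bound (G := G) (A := A) (d := d) (θ := θ) (θbar := θbar)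
    (c := c) (u := u) (d₁ := d₁) hlam0 hβ hβD hm₀ (fun i => (huU' i).1) (fun i j => (hbB' i j).1)
    hR0.le hr0 (by linarith : R + r ≤ R + r + 3 * v₁) hrR hCg0.le hks0 hCg
  set α : ℝ := 1 / (12 + 2 * U + 2 * B) with hα
  have hα0 : 0 < α := by positivity
  have key : ∀ (X : ℝ → State N) (τ : ℝ), t₀ ≤ τ →
      IsSolutionOn ⟨G.cost, A, g, d, ⟨θ, θbar, ks, c, β⟩⟩ t₀ τ X →
      Loop.errNorm ⟨G.cost, A, g, d, ⟨θ, θbar, ks, c, β⟩⟩ xs t₀ (X t₀) ≤ v₁ →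
      ∀ t ∈ Set.Icc t₀ τ, Loop.errNorm ⟨G.cost, A, g, d, ⟨θ, θbar, ks, c, β⟩⟩ xs t (X t) ≤
        √(L * (Real.exp (-α * (t - t₀)) * (m₀ * R ^ 2))) := by
    intro X τ hτ hX herr t ht
    have hinit := (loopLyapunov_initial_le (u := u) hCg0.le hv₁.le hlam0.le hCg (by linarith)
      (fun i => (huU' i).2) (fun i j => (hbB' i j).2) hU.le hB.le hβ hβD hβv
      (fun i => (hdD t₀ le_rfl i).1) herr).trans_lt hRV
    have hbar := (hX.absolutelyContinuous_loopLyapunov (u := u) (β := β) (xs := xs) (lam := lam)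
      (b := fun i j => (θbar i j)⁻¹) (ks := ks) hg (hdac τ hτ)).le_exp_mul_of_barrier hα0.le
      (fun t ht => (lyapunov_components hlam0.le hβ hβD (fun i => (hdD t ht.1 i).1) hm₀.le
        (fun i => (huU' i).1) (fun i j => (hbB' i j).1)).1) hinit
      (hX.ae_loopLyapunov_decay hg hxs hτ hdd hdD (fun κ hκ => hform θ hθ R κ hκ)
        (fun p q e p' w Δ he hp' hw hΔ => hdrift ks (fun i => ks i + c i) p q e p' w Δ
          (fun i => ⟨hks0 i, by linarith [hkcS i, hc1 i]⟩) (fun i => ⟨hkc0 i, hkcS i⟩) he hp' hw hΔ)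
        hCg0.le hCg hC hR0 hr0 (by linarith) hlam hrR hm₀ huU' hbB' hU.le hB.le
        (fun i => (hks i).le) hc1 hcθ hcg hβ hβD hβM) ht
    refine (hL t (X t) (fun i => (hdD t ht.1 i).1) hbar.1).trans (Real.sqrt_le_sqrt ?_)
    refine mul_le_mul_of_nonneg_left (hbar.2.trans ?_) hL0
    exact mul_le_mul_of_nonneg_left hinit.le (Real.exp_pos _).le
  refine ⟨⟨√(L * (1 * (m₀ * R ^ 2))), fun X τ hτ hX herr t ht => (key X τ hτ hX herr t ht).trans ?_⟩,
    fun X hX herr => ?_⟩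
  · have h1 : Real.exp (-α * (t - t₀)) ≤ 1 := by
      rw [Real.exp_le_one_iff]
      nlinarith [ht.1]
    gcongr
  · have hlim : Tendsto (fun t => √(L * (Real.exp (-α * (t - t₀)) * (m₀ * R ^ 2)))) atTop (𝓝 0) := by
      have h1 : Tendsto (fun t => -α * (t - t₀)) atTop atBot :=
        (tendsto_atTop_add_const_right _ _ tendsto_id).const_mul_atTop_of_neg (neg_neg_of_pos hα0)
      have h2 := ((Real.tendsto_exp_atBot.comp h1).mul_const (m₀ * R ^ 2)).const_mul L
      simpa using h2.sqrt
    have herr0 : Tendsto (fun t => Loop.errNorm ⟨G.cost, A, g, d, ⟨θ, θbar, ks, c, β⟩⟩ xs t (X t))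
        atTop (𝓝 0) := by
      refine squeeze_zero' (Eventually.of_forall fun t => Real.sqrt_nonneg _) ?_ hlim
      filter_upwards [eventually_ge_atTop t₀] with t ht
      exact key X t ht (hX t ht) herr t ⟨ht, le_rfl⟩
    refine ⟨herr0, fun i => ?_⟩
    rw [tendsto_iff_norm_sub_tendsto_zero]
    exact squeeze_zero (fun t => norm_nonneg _)
      (fun t => (Loop.norm_le_errNorm _ xs t (X t)).2.2.1 i) herr0
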